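/- **Setting.** Let $d\ge1$, $n\ge 0$ be integers. A *critical radius function* is $\rho:\mathbb{R}^d\to(0,\infty)$ for which there are constants $C_0,N_0>0$ with $$C_0^{-1}\rho(x)\Big(1+\frac{|x-y|}{\rho(x)}\Big)^{-N_0}\le\rho(y)\le C_0\,\rho(x)\Big(1+\frac{|x-y|}{\rho(x)}\Big)^{\frac{N_0}{N_0+1}}\qquad(x,y\in\mathbb{R}^d).$$ Let $L$ be a non-negative self-adjoint operator on $L^2(\mathbb{R}^d)$ (complex valued functions) and suppose that the semigroup $e^{-tL}$ generated by $-L$ has kernels $p_t(x,y)$, $t>0$ (measurable in $(t,x,y)$), such that for every $N>0$ there are $c,C>0$ with $$|p_t(x,y)|\le\frac{C}{t^{d/2}}e^{-\frac{|x-y|^2}{ct}}\Big(1+\frac{\sqrt t}{\rho(x)}+\frac{\sqrt t}{\rho(y)}\Big)^{-N}\qquad(x,y\in\mathbb{R}^d,\ t>0).$$ For $0<\alpha<d$ and measurable $\vec f:\mathbb{R}^d\to\mathbb{C}^n$ put $$L^{-\alpha/2}\vec f(x)=\int_0^\infty e^{-tL}\vec f(x)\,t^{\frac\alpha2-1}\,dt,\qquad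 e^{-tL}\vec f(x)=\int_{\mathbb{R}^d}p_t(x,y)\vec f(y)\,dy .$$ A *matrix weight* is a function $W:\mathbb{R}^d\to\mathbb{C}^{n\times n}$ with locally integrable entries such that $W(x)$ is self-adjoint and positive definite for a.e. $x$; powers $W^r$, $r\in\mathbb{R}$, are defined by diagonalization. For $1<r<\infty$, $L^r(W)$ is the set of measurable $\vec f:\mathbb{R}^d\to\mathbb{C}^n$ with $\|\vec f\|_{L^r(W)}=\big(\int_{\mathbb{R}^d}|W(x)^{1/r}\vec f(x)|^r\,dx\big)^{1/r}<\infty$. A *Young function* is a continuous, increasing (not necessarily strictly), convex $\Phi:[0,\infty)\to[0,\infty)$ with $\Phi(0)=0$ and $\lim_{t\to\infty}\Phi(t)/t=\infty$; its complementary function is $\bar\Phi(t)=\sup_{s>0}\{st-\Phi(s)\}$. For $1<p\le s<\infty$, $A\in B_{p,s}$ means $\int_1^\infty\frac{A(t)^{s/p}}{t^s}\frac{dt}{t}<\infty$. For a cube $Q$ (sides parallel to the axes, center $x_Q$, side length $l_Q$) let $$\|g\|_{\Phi,Q}=\inf\Big\{\lambda>0:\frac1{|Q|}\int_Q\Phi\Big(\frac{|g(x)|}{\lambda}\Big)dx\le1\Big\},\qquad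 \psi_\theta(Q)=\Big(1+\frac{l_Q}{\rho(x_Q)}\Big)^\theta ,$$ with $\Phi(\infty)=\infty$ and $\inf\emptyset=\infty$. For matrix weights $U,V$ put $$[U,V]_{p,q,\alpha,\psi_\theta,\Phi,\Psi}=\sup_Q\frac{|Q|^{\alpha/d+1/q-1/p}}{\psi_{\theta/3}(Q)}\Big\|\big\|\,|U(x)^{1/q}V(y)^{-1/q}|_{op}\big\|_{\Phi_y,Q}\Big\|_{\Psi_x,Q},$$ where the subscripts $y$ and $x$ indicate the variable in which the norm is taken. **Theorem.** Let $0<\alpha<d$, $\theta\ge0$, $p<q$ and $1<p\le s\le q<\infty$. Let $\Phi,\Psi$ be Young functions with $\bar\Phi\in B_{p,s}$ and $\bar\Psi\in B_{q',s'}$, where $q'=q/(q-1)$, $s'=s/(s-1)$. Then there is a constant $C$, independent of $U$, $V$ and $\vec f$, such that for every pair $(U,V)$ of matrix weights with $[U,V]_{p,q,\alpha,\psi_\theta,\Phi,\Psi}<\infty$ and every $\vec f\in L^p(V^{p/q})$: the double integral over $(t,y)\in(0,\infty)\times\mathbb{R}^d$ which defines $L^{-\alpha/2}\vec f(x)$ converges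 absolutely for a.e. $x$, $L^{-\alpha/2}\vec f\in L^q(U)$, and $$\|L^{-\alpha/2}\vec f\|_{L^q(U)}\le C\,[U,V]_{p,q,\alpha,\psi_\theta,\Phi,\Psi}\,\|\vec f\|_{L^p(V^{p/q})}.$$ -/

import Mathlib

open MeasureTheory Filter Topology
open scoped ENNReal NNReal ComplexOrder

noncomputable section

namespace MatrixBump

/-- `ℝᵈ` with its Euclidean norm. -/
abbrev Rd (d : ℕ) : Type := EuclideanSpace ℝ (Fin d)

/-- `ℂⁿ` with its Euclidean norm. -/
abbrev Cn (n : ℕ) : Type := EuclideanSpace ℂ (Fin n)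

/-- The complex Hilbert space `L²(ℝᵈ)`. -/
abbrev L2 (d : ℕ) : Type := Lp ℂ 2 (volume : Measure (Rd d))

/-! ### Cubes and critical radius functions -/

/-- The cube with sides parallel to the axes, center `x` and side length `2 * r`. -/
def cube {d : ℕ} (x : Rd d) (r : ℝ) : Set (Rd d) := {y | ∀ i, |y i - x i| ≤ r}

/-- `ρ : ℝᵈ → (0, ∞)` is a critical radius function. -/
def IsCriticalRadius {d : ℕ} (ρ : Rd d → ℝ) : Prop :=
  (∀ x, 0 < ρ x) ∧
  ∃ C₀ : ℝ, 0 < C₀ ∧ ∃ N₀ : ℝ, 0 < N₀ ∧ ∀ x y : Rd d,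
    C₀⁻¹ * ρ x * (1 + ‖x - y‖ / ρ x) ^ (-N₀) ≤ ρ y ∧
    ρ y ≤ C₀ * ρ x * (1 + ‖x - y‖ / ρ x) ^ (N₀ / (N₀ + 1))

/-- `ψ_θ(Q) = (1 + l_Q / ρ(x_Q)) ^ θ` for the cube `Q` of center `x` and side length `2 * r`. -/
def psi {d : ℕ} (ρ : Rd d → ℝ) (θ : ℝ) (x : Rd d) (r : ℝ) : ℝ :=
  (1 + 2 * r / ρ x) ^ θ

/-! ### Heat semigroups and their kernels -/

/-- A nonnegative self-adjoint, in general unbounded, operator on `L²(ℝᵈ)`. -/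
structure IsNonnegSelfAdjoint {d : ℕ} (L : L2 d →ₗ.[ℂ] L2 d) : Prop where
  selfAdjoint : IsSelfAdjoint L
  nonneg : ∀ f : L.domain, 0 ≤ (inner ℂ (f : L2 d) (L f)).re

/-- `S t = e^{-tL}` for `t ≥ 0`: the family `S` is the strongly continuous semigroup whose
infinitesimal generator, domain included, is `-L`. -/
structure IsSemigroupOf {d : ℕ} (L : L2 d →ₗ.[ℂ] L2 d) (S : ℝ → L2 d →L[ℂ] L2 d) : Prop where
  map_zero : S 0 = ContinuousLinearMap.id ℂ (L2 d)
  map_add : ∀ s t : ℝ, 0 ≤ s → 0 ≤ t → S (s + t) = (S s).comp (S t)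
  continuousOn : ∀ f : L2 d, ContinuousOn (fun t => S t f) (Set.Ici 0)
  generator : ∀ f g : L2 d, (f, g) ∈ L.graph ↔
    Tendsto (fun t : ℝ => (t⁻¹ : ℂ) • (S t f - f)) (𝓝[>] 0) (𝓝 (-g))

/-- `k t x y`, for `t > 0`, is the kernel of `e^{-tL}` (the values at `t ≤ 0` play no role). -/
structure IsHeatKernel {d : ℕ} (L : L2 d →ₗ.[ℂ] L2 d) (k : ℝ → Rd d → Rd d → ℂ) : Prop where
  measurable : Measurable fun z : ℝ × Rd d × Rd d => k z.1 z.2.1 z.2.2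
  kernel : ∃ S : ℝ → L2 d →L[ℂ] L2 d, IsSemigroupOf L S ∧
    ∀ t : ℝ, 0 < t → ∀ f : L2 d,
      (S t f : Rd d → ℂ) =ᵐ[volume] fun x => ∫ y, k t x y * f y

/-- The Gaussian upper bound with extra decay at the scale `ρ`. -/
def HeatKernelBound {d : ℕ} (ρ : Rd d → ℝ) (k : ℝ → Rd d → Rd d → ℂ) : Prop :=
  ∀ N : ℝ, 0 < N → ∃ c : ℝ, 0 < c ∧ ∃ C : ℝ, 0 < C ∧ ∀ (x y : Rd d) (t : ℝ), 0 < t →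
    ‖k t x y‖ ≤ C / t ^ ((d : ℝ) / 2) * Real.exp (-(‖x - y‖ ^ 2 / (c * t))) *
      (1 + √t / ρ x + √t / ρ y) ^ (-N)

/-- The integrand `t ^ (α/2 - 1) p_t(x, y) f(y)` of the fractional integral at the point `x`. -/
def fracIntegrand {d n : ℕ} (k : ℝ → Rd d → Rd d → ℂ) (α : ℝ) (f : Rd d → Cn n) (x : Rd d)
    (t : ℝ) (y : Rd d) : Cn n :=
  t ^ (α / 2 - 1) • (k t x y • f y)

/-- `L^{-α/2} f(x) = ∫₀^∞ e^{-tL} f(x) t ^ (α/2 - 1) dt`, where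
`e^{-tL} f(x) = ∫ p_t(x, y) f(y) dy` acts on each component of `f`. -/
def fracInt {d n : ℕ} (k : ℝ → Rd d → Rd d → ℂ) (α : ℝ) (f : Rd d → Cn n) (x : Rd d) : Cn n :=
  ∫ t in Set.Ioi (0 : ℝ), ∫ y, fracIntegrand k α f x t y

/-! ### Matrix weights -/

/-- The power `A ^ r` of a positive definite matrix, by diagonalization: if `A = O D(λᵢ) O*` with `O`
unitary, then `A ^ r = O D(λᵢ ^ r) O*`. -/
def mpow {n : ℕ} (A : Matrix (Fin n) (Fin n) ℂ) (r : ℝ) : Matrix (Fin n) (Fin n) ℂ :=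
  cfc (fun s : ℝ => s ^ r) A

/-- A matrix as an operator on the Euclidean space `ℂⁿ`. -/
def toOp {n : ℕ} (A : Matrix (Fin n) (Fin n) ℂ) : Cn n →L[ℂ] Cn n :=
  Matrix.toEuclideanCLM (𝕜 := ℂ) A

/-- A matrix weight: locally integrable entries, self-adjoint and positive definite a.e. -/
structure IsMatrixWeight {d n : ℕ} (W : Rd d → Matrix (Fin n) (Fin n) ℂ) : Prop where
  locallyIntegrable : ∀ i j, LocallyIntegrable (fun x => W x i j) volume
  posDef : ∀ᵐ x ∂volume, (W x).PosDef

/-- `‖f‖_{L^r(W)} = (∫ |W(x) ^ (1/r) f(x)| ^ r dx) ^ (1/r)`. -/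
def wNorm {d n : ℕ} (W : Rd d → Matrix (Fin n) (Fin n) ℂ) (r : ℝ) (f : Rd d → Cn n) : ℝ≥0∞ :=
  eLpNorm (fun x => toOp (mpow (W x) (1 / r)) (f x)) (ENNReal.ofReal r) volume

/-- `f ∈ L^r(W)`. -/
def MemWLp {d n : ℕ} (W : Rd d → Matrix (Fin n) (Fin n) ℂ) (r : ℝ) (f : Rd d → Cn n) : Prop :=
  AEStronglyMeasurable f volume ∧ wNorm W r f < ∞

/-! ### Young functions and Orlicz norms -/

/-- A Young function on `[0, ∞)`; values at negative arguments play no role. -/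
structure IsYoung (Φ : ℝ → ℝ) : Prop where
  nonneg : ∀ t, 0 ≤ t → 0 ≤ Φ t
  continuousOn : ContinuousOn Φ (Set.Ici 0)
  monotoneOn : MonotoneOn Φ (Set.Ici 0)
  convexOn : ConvexOn ℝ (Set.Ici 0) Φ
  map_zero : Φ 0 = 0
  superlinear : Tendsto (fun t => Φ t / t) atTop atTop

/-- The complementary function `t ↦ sup_{s > 0} (s t - Φ(s))`. -/
def conjYoung (Φ : ℝ → ℝ) (t : ℝ) : ℝ := ⨆ s : Set.Ioi (0 : ℝ), ((s : ℝ) * t - Φ s)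

/-- `A ∈ B_{p,s}`: the integral `∫₁^∞ A(t) ^ (s/p) t ^ (-s) dt/t` is finite. -/
def MemB (A : ℝ → ℝ) (p s : ℝ) : Prop :=
  IntegrableOn (fun t => A t ^ (s / p) / t ^ s * (1 / t)) (Set.Ioi 1) volume

/-- A Young function extended to `[0, ∞]` by `Φ(∞) = ∞`. -/
def youngExt (Φ : ℝ → ℝ) (t : ℝ≥0∞) : ℝ≥0∞ :=
  if t = ∞ then ∞ else ENNReal.ofReal (Φ t.toReal)

/-- The localized Orlicz (Luxemburg) norm on `Q` of a `[0, ∞]`-valued function. -/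
def orliczNorm {d : ℕ} (Φ : ℝ → ℝ) (Q : Set (Rd d)) (g : Rd d → ℝ≥0∞) : ℝ≥0∞ :=
  ⨅ (l : ℝ≥0) (_ : 0 < l ∧
    (volume Q)⁻¹ * ∫⁻ x in Q, youngExt Φ (g x / (l : ℝ≥0∞)) ≤ 1), (l : ℝ≥0∞)

/-- The bump constant `[U, V]_{p,q,α,ψ_θ,Φ,Ψ}`, a supremum over all cubes. -/
def bumpConst {d n : ℕ} (ρ : Rd d → ℝ) (p q α θ : ℝ) (Φ Ψ : ℝ → ℝ)
    (U V : Rd d → Matrix (Fin n) (Fin n) ℂ) : ℝ≥0∞ :=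
  ⨆ (z : Rd d) (r : ℝ) (_ : 0 < r),
    volume (cube z r) ^ (α / d + 1 / q - 1 / p) / ENNReal.ofReal (psi ρ (θ / 3) z r) *
      orliczNorm Ψ (cube z r) (fun x => orliczNorm Φ (cube z r) (fun y =>
        ‖toOp (mpow (U x) (1 / q) * mpow (V y) (-(1 / q)))‖ₑ))

end MatrixBump

end

/-! The matrices disappear at once. Writing f(y) = V(y)^{-1/q} V(y)^{1/q} f(y) bounds |U(x)^{1/q}
f(y)| by w(x,y) g(y), where w(x,y) = |U(x)^{1/q} V(y)^{-1/q}|_op and g = |V^{1/q} f|; the L^p norm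
of g is the norm of f in L^p(V^{p/q}). So everything follows from an L^p → L^q bound for the
positive scalar operator with kernel K w, where K(x,y) = ∫ |p_t(x,y)| t^{α/2-1} dt
(`posOp_strong_type`). Absolute convergence comes from the same bound.

Heat kernel decay gives K ≲ |x-y|^{α-d} (1+|x-y|/ρ(x))^{-N} for every N (`absKernel_le`). Two
distinct points share a cube Q of side at most 6|x-y| in one of 2^d adjacent dyadic grids, and for N
large the critical radius condition turns the decay into 1/ψ_{θ/3}(Q). Hence K is dominated by a sum
of |Q|^{α/d-1} ψ_{θ/3}(Q)^{-1} 1_Q(x) 1_Q(y) over dyadic cubes (`absKernel_le_gridCube`). Test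
against h and apply Hölder for Luxemburg norms in y, then in x: each cube contributes at most a
constant times |Q|^{1+1/p-1/q} ‖g‖_{Φ̄,Q} ‖h‖_{Ψ̄,Q}.

It remains to sum this over a grid (`nested_sum_le`). As p < q, the power of |Q| exceeds 1 by 2δ =
1/p - 1/q. One δ makes the sum of |Q|^{1+δ} over the cubes inside a given cube geometric; the other
enters a score m(Q) = |Q|^δ ‖g‖ ‖h‖. Keeping only the cubes whose score has a higher level (in
powers of 4) than that of every larger cube containing them loses a constant factor and leaves a
family with a Carleson packing property (`exists_sparse_subfamily`): a subcube of much higher score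
must have one of its two norms large, and such cubes fill little volume. Hölder with exponents s and
s' then separates g from h, and `carleson_embedding` bounds each factor without a maximal operator:
the cubes with norm about 2^j have total volume ≲ ∫ (A(g/2^j) - 1/2)_+, and Minkowski's inequality
with exponent s/p and the dyadic form of B_{p,s} sum over j. -/

namespace MatrixBump

/-! ### Young functions and Luxemburg norms -/

/-- The properties of a Young function used for Luxemburg norms. -/
structure OrliczFun (A : ℝ → ℝ) : Prop where
  nonneg : ∀ t, 0 ≤ t → 0 ≤ A t
  monotoneOn : MonotoneOn A (Set.Ici 0)
  map_zero : A 0 = 0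
  star : ∀ c t, 0 ≤ c → c ≤ 1 → 0 ≤ t → A (c * t) ≤ c * A t
  tendsto : Tendsto A atTop atTop

lemma IsYoung.bddAbove {Φ : ℝ → ℝ} (h : IsYoung Φ) (t : ℝ) :
    BddAbove (Set.range fun s : Set.Ioi (0 : ℝ) => (s : ℝ) * t - Φ s) := by
  obtain ⟨M, hM⟩ := (h.superlinear.eventually_ge_atTop t).exists_forall_of_atTop
  refine ⟨max M 1 * |t|, ?_⟩
  rintro _ ⟨⟨s, hs⟩, rfl⟩
  have hs' : 0 < s := hs
  have h0 := h.nonneg s hs'.le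
  show s * t - Φ s ≤ max M 1 * |t|
  rcases le_total M s with hMs | hMs
  · have := hM s hMs
    rw [le_div_iff₀ hs'] at this
    have h2 : 0 ≤ max M 1 * |t| := by positivity
    nlinarith
  · have h1 : s * t ≤ s * |t| := mul_le_mul_of_nonneg_left (le_abs_self t) hs'.le
    have h2 : s * |t| ≤ max M 1 * |t| :=
      mul_le_mul_of_nonneg_right (hMs.trans (le_max_left _ _)) (abs_nonneg t)
    linarith

lemma IsYoung.sub_le_conj {Φ : ℝ → ℝ} (h : IsYoung Φ) {s : ℝ} (hs : 0 < s) (t : ℝ) :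
    s * t - Φ s ≤ conjYoung Φ t :=
  le_ciSup (h.bddAbove t) (⟨s, hs⟩ : Set.Ioi (0 : ℝ))

/-- The supremum runs over s > 0 only, so the value 0 is reached in the limit s → 0, by continuity
of Φ at 0. -/
lemma IsYoung.conj_nonneg {Φ : ℝ → ℝ} (h : IsYoung Φ) (t : ℝ) (ht : 0 ≤ t) :
    0 ≤ conjYoung Φ t := by
  have hc : Tendsto (fun s => Φ s) (𝓝[>] 0) (𝓝 0) := by
    have := (h.continuousOn 0 Set.self_mem_Ici).tendsto
    rw [h.map_zero] at this
    exact this.mono_left (nhdsWithin_mono _ Set.Ioi_subset_Ici_self)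
  have h2 : Tendsto (fun s => - Φ s) (𝓝[>] 0) (𝓝 (-0)) := hc.neg
  rw [neg_zero] at h2
  refine le_of_tendsto h2 ?_
  filter_upwards [self_mem_nhdsWithin] with s hs
  have := h.sub_le_conj hs t
  have h3 : 0 ≤ s * t := mul_nonneg (le_of_lt hs) ht
  linarith

lemma IsYoung.young_ineq {Φ : ℝ → ℝ} (h : IsYoung Φ) {s t : ℝ} (hs : 0 ≤ s) (ht : 0 ≤ t) :
    s * t ≤ Φ s + conjYoung Φ t := by
  rcases hs.eq_or_lt with rfl | hs
  · have := h.conj_nonneg t ht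
    rw [h.map_zero]; linarith
  · linarith [h.sub_le_conj hs t]

lemma IsYoung.orliczFun {Φ : ℝ → ℝ} (h : IsYoung Φ) : OrliczFun Φ where
  nonneg := h.nonneg
  monotoneOn := h.monotoneOn
  map_zero := h.map_zero
  star c t h0 h1 ht := by
    have := h.convexOn.2 (Set.mem_Ici.2 le_rfl) (Set.mem_Ici.2 ht) (sub_nonneg.2 h1) h0 (by ring)
    simpa [h.map_zero] using this
  tendsto := by
    have h1 := h.superlinear.atTop_mul_atTop₀ tendsto_id
    refine h1.congr' ?_
    filter_upwards [eventually_gt_atTop 0] with t ht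
    simp only [id]
    field_simp

/-- Starshapedness replaces convexity: since Φ ≥ 0, c s t - Φ(s) ≤ c (s t - Φ(s)) for c ≤ 1. Testing
with s = 1 gives growth at infinity. -/
lemma IsYoung.orliczFun_conj {Φ : ℝ → ℝ} (h : IsYoung Φ) : OrliczFun (conjYoung Φ) where
  nonneg := h.conj_nonneg
  monotoneOn := by
    intro a _ b _ hab
    have : Nonempty (Set.Ioi (0 : ℝ)) := ⟨⟨1, Set.mem_Ioi.2 one_pos⟩⟩
    refine ciSup_mono (h.bddAbove b) fun s => ?_
    have : (s : ℝ) * a ≤ s * b := mul_le_mul_of_nonneg_left hab (le_of_lt s.2)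
    linarith
  map_zero := by
    have : Nonempty (Set.Ioi (0 : ℝ)) := ⟨⟨1, Set.mem_Ioi.2 one_pos⟩⟩
    refine le_antisymm (ciSup_le fun s => ?_) (h.conj_nonneg 0 le_rfl)
    have := h.nonneg s (le_of_lt s.2)
    linarith
  star c t h0 h1 ht := by
    have : Nonempty (Set.Ioi (0 : ℝ)) := ⟨⟨1, Set.mem_Ioi.2 one_pos⟩⟩
    refine ciSup_le fun s => ?_
    have h2 := mul_le_mul_of_nonneg_left (h.sub_le_conj s.2 t) h0
    have h3 := h.nonneg s (le_of_lt s.2)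
    nlinarith
  tendsto := by
    refine tendsto_atTop_mono (fun t => ?_)
      (tendsto_atTop_add_const_right atTop (-Φ 1) tendsto_id)
    have := h.sub_le_conj one_pos t
    simp only [id]; linarith

lemma youngExt_mono {A : ℝ → ℝ} (hA : OrliczFun A) : Monotone (youngExt A) := by
  intro a b hab
  unfold youngExt
  by_cases hb : b = ∞
  · simp [hb]
  · have ha : a ≠ ∞ := ne_top_of_le_ne_top hb hab
    rw [if_neg ha, if_neg hb]
    exact ENNReal.ofReal_le_ofReal (hA.monotoneOn (Set.mem_Ici.2 ENNReal.toReal_nonneg)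
      (Set.mem_Ici.2 ENNReal.toReal_nonneg) (ENNReal.toReal_mono hb hab))

lemma youngExt_measurable {A : ℝ → ℝ} (hA : OrliczFun A) : Measurable (youngExt A) :=
  (youngExt_mono hA).measurable

lemma youngExt_zero {A : ℝ → ℝ} (hA : OrliczFun A) : youngExt A 0 = 0 := by
  simp [youngExt, hA.map_zero]

lemma youngExt_mul_le {A : ℝ → ℝ} (hA : OrliczFun A) (c : ℝ≥0) (hc : c ≤ 1) (u : ℝ≥0∞)
    (hu : u ≠ ∞) :
    youngExt A (c * u) ≤ c * youngExt A u := by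
  unfold youngExt
  rw [if_neg hu, if_neg (ENNReal.mul_ne_top ENNReal.coe_ne_top hu), ENNReal.toReal_mul,
    ENNReal.coe_toReal]
  conv_rhs => rw [← ENNReal.ofReal_coe_nnreal (p := c), ← ENNReal.ofReal_mul c.coe_nonneg]
  exact ENNReal.ofReal_le_ofReal (hA.star c _ c.coe_nonneg (by exact_mod_cast hc) ENNReal.toReal_nonneg)

lemma mul_le_youngExt_add {Φ : ℝ → ℝ} (h : IsYoung Φ) (u v : ℝ≥0∞) :
    u * v ≤ youngExt Φ u + youngExt (conjYoung Φ) v := by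
  by_cases hu : u = ∞
  · simp [youngExt, hu]
  by_cases hv : v = ∞
  · simp [youngExt, hv]
  unfold youngExt
  rw [if_neg hu, if_neg hv, ← ENNReal.ofReal_add (h.nonneg _ ENNReal.toReal_nonneg)
    (h.conj_nonneg _ ENNReal.toReal_nonneg), ← ENNReal.ofReal_toReal (ENNReal.mul_ne_top hu hv),
    ENNReal.toReal_mul]
  exact ENNReal.ofReal_le_ofReal (h.young_ineq ENNReal.toReal_nonneg ENNReal.toReal_nonneg)

section orlicz
variable {d : ℕ} {A : ℝ → ℝ} {Q : Set (Rd d)} {g : Rd d → ℝ≥0∞}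

lemma inv_mul_le_one_iff (h0 : volume Q ≠ 0) (hT : volume Q ≠ ∞) (I : ℝ≥0∞) :
    (volume Q)⁻¹ * I ≤ 1 ↔ I ≤ volume Q := by
  rw [mul_comm, ← div_eq_mul_inv, ENNReal.div_le_iff h0 hT, one_mul]

/-- The strict inequality spares a proof that the infimum in the Luxemburg norm is attained: some
admissible level lies below `l`. -/
lemma lintegral_le_of_orliczNorm_lt (hA : OrliczFun A) (h0 : volume Q ≠ 0) (hT : volume Q ≠ ∞)
    {l : ℝ≥0} (h : orliczNorm A Q g < l) :
    ∫⁻ x in Q, youngExt A (g x / l) ≤ volume Q := by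
  unfold orliczNorm at h
  simp only [iInf_lt_iff] at h
  obtain ⟨m, ⟨_, hm⟩, hml⟩ := h
  rw [inv_mul_le_one_iff h0 hT] at hm
  exact (lintegral_mono fun x => youngExt_mono hA (ENNReal.div_le_div_left hml.le _)).trans hm

lemma lt_lintegral_of_lt_orliczNorm (h0 : volume Q ≠ 0) (hT : volume Q ≠ ∞)
    {l : ℝ≥0} (hl : 0 < l) (h : l < orliczNorm A Q g) :
    volume Q < ∫⁻ x in Q, youngExt A (g x / l) := by
  by_contra hcon
  rw [not_lt] at hcon
  refine h.not_ge ?_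
  exact iInf₂_le l ⟨hl, (inv_mul_le_one_iff h0 hT _).2 hcon⟩

lemma exists_youngExt_le_one (hA : OrliczFun A) : ∃ c : ℝ≥0, 0 < c ∧ youngExt A c ≤ 1 := by
  have h1 := hA.nonneg 1 zero_le_one
  -- With c = 1/(A(1) + 1) starshapedness gives A(c) ≤ c A(1) ≤ 1.
  refine ⟨Real.toNNReal (A 1 + 1)⁻¹, by rw [Real.toNNReal_pos]; positivity, ?_⟩
  unfold youngExt
  rw [if_neg ENNReal.coe_ne_top, ENNReal.coe_toReal, ENNReal.ofReal_le_one,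
    Real.coe_toNNReal _ (by positivity)]
  have := hA.star (A 1 + 1)⁻¹ 1 (by positivity) (inv_le_one_of_one_le₀ (by linarith)) zero_le_one
  rw [mul_one] at this
  refine this.trans ?_
  rw [inv_mul_le_iff₀ (by positivity)]
  linarith

lemma orliczNorm_lt_top_of_le (hA : OrliczFun A) (h0 : volume Q ≠ 0) (hT : volume Q ≠ ∞)
    (N : ℝ≥0) (hg : ∀ x, g x ≤ N) : orliczNorm A Q g < ∞ := by
  obtain ⟨c, hc, hA1⟩ := exists_youngExt_le_one hA
  have hl : 0 < (N + 1) / c := by positivity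
  refine lt_of_le_of_lt (iInf₂_le ((N + 1) / c) ⟨hl, ?_⟩) ENNReal.coe_lt_top
  rw [inv_mul_le_one_iff h0 hT]
  calc ∫⁻ x in Q, youngExt A (g x / ((N + 1) / c : ℝ≥0))
      ≤ ∫⁻ x in Q, 1 := by
        refine lintegral_mono fun x => (youngExt_mono hA ?_).trans hA1
        rw [ENNReal.div_le_iff (by exact_mod_cast hl.ne') ENNReal.coe_ne_top]
        refine (hg x).trans ?_
        norm_cast
        rw [mul_div_cancel₀ _ hc.ne']
        exact le_self_add
    _ = volume Q := by simp

/-- If g ≥ 1/(n+1) on a set of measure m > 0, Chebyshev at the level 1/((n+1)t) gives A(t) m ≤ |Q|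
for all t > 0, which fails because A is unbounded. -/
lemma ae_eq_zero_of_orliczNorm_eq_zero (hA : OrliczFun A) (h0 : volume Q ≠ 0)
    (hT : volume Q ≠ ∞) (hg : Measurable g) (h : orliczNorm A Q g = 0) :
    ∀ᵐ x ∂(volume.restrict Q), g x = 0 := by
  have key : ∀ n : ℕ, (volume.restrict Q) {x | ((n : ℝ≥0∞) + 1)⁻¹ ≤ g x} = 0 := by
    intro n
    by_contra hne
    set m := (volume.restrict Q) {x | ((n : ℝ≥0∞) + 1)⁻¹ ≤ g x} with hm
    have hmT : m ≠ ∞ := ne_top_of_le_ne_top hT ((measure_mono (Set.subset_univ _)).trans (by simp))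
    have hlarge : ∃ t : ℝ, 0 < t ∧ (volume Q / m).toReal < A t :=
      ((eventually_gt_atTop (0 : ℝ)).and
        (hA.tendsto.eventually_gt_atTop (volume Q / m).toReal)).exists
    obtain ⟨t, ht, hAt⟩ := hlarge
    set l : ℝ≥0 := Real.toNNReal (((n : ℝ) + 1) * t)⁻¹ with hl
    have hl0 : 0 < l := by
      rw [hl, Real.toNNReal_pos]
      positivity
    have h1 : ∫⁻ x in Q, youngExt A (g x / l) ≤ volume Q :=
      lintegral_le_of_orliczNorm_lt hA h0 hT (by rw [h]; exact_mod_cast hl0)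
    have h2 : ENNReal.ofReal (A t) * m ≤ ∫⁻ x in Q, youngExt A (g x / l) := by
      refine le_trans ?_ (mul_meas_ge_le_lintegral
        ((youngExt_measurable hA).comp (hg.div_const _)) (ENNReal.ofReal (A t)))
      refine mul_le_mul' le_rfl (measure_mono fun x hx => ?_)
      have hx' : ((n : ℝ≥0∞) + 1)⁻¹ ≤ g x := hx
      have h3 : ENNReal.ofReal t ≤ g x / l := by
        refine le_trans ?_ (ENNReal.div_le_div_right hx' _)
        have e1 : ((n : ℝ≥0∞) + 1)⁻¹ = ENNReal.ofReal ((n : ℝ) + 1)⁻¹ := by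
          rw [ENNReal.ofReal_inv_of_pos (by positivity),
            ENNReal.ofReal_add (by positivity) zero_le_one]
          simp
        have e2 : (l : ℝ≥0∞) = ENNReal.ofReal (((n : ℝ) + 1) * t)⁻¹ := rfl
        rw [e1, e2, ← ENNReal.ofReal_div_of_pos (by positivity)]
        refine ENNReal.ofReal_le_ofReal (le_of_eq ?_)
        field_simp
      show ENNReal.ofReal (A t) ≤ youngExt A (g x / l)
      refine le_trans (le_of_eq ?_) (youngExt_mono hA h3)
      simp [youngExt, ENNReal.toReal_ofReal ht.le]
    have h3 := h2.trans h1
    rw [← ENNReal.le_div_iff_mul_le (Or.inl hne) (Or.inl hmT)] at h3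
    have h4 := (ENNReal.ofReal_le_iff_le_toReal (ENNReal.div_ne_top hT hne)).1 h3
    linarith
  have h5 := ae_all_iff.2 fun n => (measure_eq_zero_iff_ae_notMem.1 (key n))
  filter_upwards [h5] with x hx
  by_contra hgx
  obtain ⟨n, hn⟩ := ENNReal.exists_inv_nat_lt hgx
  refine hx n (le_trans (ENNReal.inv_le_inv.2 ?_) hn.le)
  exact le_self_add

/-- Hölder's inequality for Luxemburg norms; only one factor needs to be measurable. -/
lemma lintegral_mul_le_orliczNorm {Φ : ℝ → ℝ} (h : IsYoung Φ) (h0 : volume Q ≠ 0)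
    (hT : volume Q ≠ ∞) (w : Rd d → ℝ≥0∞) (hg : Measurable g)
    (hg1 : orliczNorm (conjYoung Φ) Q g ≠ ∞) :
    ∫⁻ x in Q, w x * g x ≤
      2 * volume Q * (orliczNorm Φ Q w * orliczNorm (conjYoung Φ) Q g) := by
  have hA := h.orliczFun_conj
  have hB := h.orliczFun
  -- Treated apart: if the other norm is ∞, the right side is 0 · ∞ = 0, so g must be shown to
  -- vanish a.e.
  by_cases hg0 : orliczNorm (conjYoung Φ) Q g = 0
  · have := ae_eq_zero_of_orliczNorm_eq_zero hA h0 hT hg hg0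
    rw [lintegral_congr_ae (g := fun _ => 0) (by filter_upwards [this] with x hx; simp [hx])]
    simp
  have h2 : (2 * volume Q : ℝ≥0∞) ≠ 0 := by simp [h0]
  have key : ∀ a b : ℝ≥0, 0 < a → 0 < b → orliczNorm Φ Q w < a →
      orliczNorm (conjYoung Φ) Q g < b → ∫⁻ x in Q, w x * g x ≤ 2 * volume Q * (a * b) := by
    intro a b ha hb hwa hgb
    have ha0 : (a : ℝ≥0∞) ≠ 0 := by exact_mod_cast ha.ne'
    have hb0 : (b : ℝ≥0∞) ≠ 0 := by exact_mod_cast hb.ne'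
    calc ∫⁻ x in Q, w x * g x
        = ∫⁻ x in Q, (a * b : ℝ≥0∞) * ((w x / a) * (g x / b)) := by
          refine lintegral_congr fun x => ?_
          calc w x * g x = (a * (w x / a)) * (b * (g x / b)) := by
                rw [ENNReal.mul_div_cancel ha0 ENNReal.coe_ne_top,
                  ENNReal.mul_div_cancel hb0 ENNReal.coe_ne_top]
            _ = _ := by ring
      _ = (a * b : ℝ≥0∞) * ∫⁻ x in Q, (w x / a) * (g x / b) := by
          rw [lintegral_const_mul' _ _ (by finiteness)]
      _ ≤ (a * b : ℝ≥0∞) * ∫⁻ x in Q,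
            (youngExt Φ (w x / a) + youngExt (conjYoung Φ) (g x / b)) :=
          mul_le_mul' le_rfl (lintegral_mono fun x => mul_le_youngExt_add h _ _)
      _ = (a * b : ℝ≥0∞) * ((∫⁻ x in Q, youngExt Φ (w x / a)) +
            ∫⁻ x in Q, youngExt (conjYoung Φ) (g x / b)) := by
          rw [lintegral_add_right]
          exact (youngExt_measurable hA).comp (hg.div_const _)
      _ ≤ (a * b : ℝ≥0∞) * (volume Q + volume Q) := by
          gcongr
          · exact lintegral_le_of_orliczNorm_lt hB h0 hT hwa
          · exact lintegral_le_of_orliczNorm_lt hA h0 hT hgb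
      _ = _ := by ring
  by_cases hw : orliczNorm Φ Q w = ∞
  · rw [hw, ENNReal.top_mul hg0, ENNReal.mul_top h2]
    exact le_top
  lift orliczNorm Φ Q w to ℝ≥0 using hw with x hx
  lift orliczNorm (conjYoung Φ) Q g to ℝ≥0 using hg1 with y hy
  -- `key` needs levels strictly above the norms; take norm + e and let e → 0.
  have hlim : Tendsto (fun e : ℝ≥0 => 2 * volume Q * (((x + e) * (y + e) : ℝ≥0) : ℝ≥0∞))
      (𝓝[>] 0) (𝓝 (2 * volume Q * (((x + 0) * (y + 0) : ℝ≥0) : ℝ≥0∞))) := by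
    refine ENNReal.Tendsto.const_mul (ENNReal.tendsto_coe.2 ?_) (Or.inr (by finiteness))
    exact ((by fun_prop : Continuous fun e : ℝ≥0 => (x + e) * (y + e)).tendsto 0).mono_left
      nhdsWithin_le_nhds
  rw [add_zero, add_zero, ENNReal.coe_mul] at hlim
  refine ge_of_tendsto hlim ?_
  filter_upwards [self_mem_nhdsWithin] with e he
  have he' : 0 < e := he
  rw [ENNReal.coe_mul]
  exact key (x + e) (y + e) (by positivity) (by positivity)
    (by exact_mod_cast lt_add_of_pos_right x he') (by exact_mod_cast lt_add_of_pos_right y he')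
end orlicz

/-! ### Two inequalities for sums -/

lemma sum_rpow_le_rpow_sum {ι : Type*} (T : Finset ι) (f : ι → ℝ≥0∞) {r : ℝ} (hr : 1 ≤ r) :
    ∑ i ∈ T, f i ^ r ≤ (∑ i ∈ T, f i) ^ r := by
  classical
  induction T using Finset.induction_on with
  | empty => simp
  | insert a T ha ih =>
    rw [Finset.sum_insert ha, Finset.sum_insert ha]
    exact (add_le_add le_rfl ih).trans (ENNReal.add_rpow_le_rpow_add _ _ hr)

/-- Minkowski's integral inequality for finitely many functions. -/
lemma sum_lintegral_rpow_le {X ι : Type*} [MeasurableSpace X] (μ : Measure X) (T : Finset ι)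
    (f : ι → X → ℝ≥0∞) (hf : ∀ i ∈ T, Measurable (f i)) {r : ℝ} (hr : 1 ≤ r) :
    ∑ i ∈ T, (∫⁻ x, f i x ∂μ) ^ r ≤ (∫⁻ x, (∑ i ∈ T, f i x ^ r) ^ (1 / r) ∂μ) ^ r := by
  have hr0 : 0 < r := one_pos.trans_le hr
  have hle : ∀ i ∈ T, ∀ x, f i x ≤ (∑ i ∈ T, f i x ^ r) ^ (1 / r) := by
    intro i hi x
    calc f i x = (f i x ^ r) ^ (1 / r) := by
          rw [← ENNReal.rpow_mul, mul_one_div_cancel hr0.ne', ENNReal.rpow_one]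
      _ ≤ _ := ENNReal.rpow_le_rpow
          (Finset.single_le_sum (f := fun i => f i x ^ r) (fun _ _ => zero_le) hi) (by positivity)
  rcases hr.eq_or_lt with rfl | hr1
  · simp only [ENNReal.rpow_one, div_one]
    rw [lintegral_finsetSum' T fun i hi => (hf i hi).aemeasurable]
  set X0 := ∑ i ∈ T, (∫⁻ x, f i x ∂μ) ^ r with hX
  set Y := ∫⁻ x, (∑ i ∈ T, f i x ^ r) ^ (1 / r) ∂μ with hY
  have hbY : ∀ i ∈ T, ∫⁻ x, f i x ∂μ ≤ Y := fun i hi => lintegral_mono (hle i hi)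
  by_cases hYT : Y = ∞
  · rw [hYT, ENNReal.top_rpow_of_pos hr0]; exact le_top
  have hXT : X0 ≠ ∞ := by
    refine (ENNReal.sum_lt_top.2 fun i hi => ?_).ne
    exact ENNReal.rpow_lt_top_of_nonneg hr0.le (ne_top_of_le_ne_top hYT (hbY i hi))
  by_cases hX0 : X0 = 0
  · rw [hX0]; exact zero_le
  have hconj : (r / (r - 1)).HolderConjugate r := (Real.HolderConjugate.conjExponent hr1).symm
  -- Duality in the sum: detach one factor of each r-th power, bring the sum inside the integral,
  -- and use Hölder pointwise in the index. The power of `X0` is then cancelled, which needs `X0`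
  -- finite and nonzero.
  have h1 : X0 ≤ X0 ^ (1 - 1 / r) * Y := by
    calc X0 = ∑ i ∈ T, (∫⁻ x, f i x ∂μ) ^ (r - 1) * ∫⁻ x, f i x ∂μ := by
          refine Finset.sum_congr rfl fun i hi => ?_
          conv_rhs => rw [← ENNReal.rpow_one (∫⁻ x, f i x ∂μ), ← ENNReal.rpow_mul, one_mul,
            ← ENNReal.rpow_add_of_nonneg _ _ (by linarith) zero_le_one]
          simp
      _ = ∫⁻ x, ∑ i ∈ T, (∫⁻ x, f i x ∂μ) ^ (r - 1) * f i x ∂μ := by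
          rw [lintegral_finsetSum' T fun i hi => ((hf i hi).const_mul _).aemeasurable]
          exact Finset.sum_congr rfl fun i hi => (lintegral_const_mul _ (hf i hi)).symm
      _ ≤ ∫⁻ x, X0 ^ (1 - 1 / r) * (∑ i ∈ T, f i x ^ r) ^ (1 / r) ∂μ := by
          refine lintegral_mono fun x => ?_
          refine (ENNReal.inner_le_Lp_mul_Lq T _ _ hconj).trans (le_of_eq ?_)
          congr 2
          · refine Finset.sum_congr rfl fun i hi => ?_
            rw [← ENNReal.rpow_mul, mul_div_cancel₀ _ (by linarith)]
          · field_simp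
      _ = X0 ^ (1 - 1 / r) * Y := by
          refine lintegral_const_mul _ ?_
          exact (Finset.measurable_fun_sum T fun i hi => (hf i hi).pow_const r).pow_const _
  have h2 : X0 ^ (1 / r) ≤ Y := by
    have h3 : X0 ^ (1 - 1 / r) * X0 ^ (1 / r) ≤ X0 ^ (1 - 1 / r) * Y := by
      rw [← ENNReal.rpow_add _ _ hX0 hXT]
      simpa using h1
    refine (ENNReal.mul_le_mul_iff_right ?_ ?_).1 h3
    · simp [ENNReal.rpow_eq_zero_iff, hX0, hXT]
    · exact (ENNReal.rpow_ne_top_of_ne_zero hX0 hXT)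
  calc X0 = (X0 ^ (1 / r)) ^ r := by
        rw [← ENNReal.rpow_mul, one_div_mul_cancel hr0.ne', ENNReal.rpow_one]
    _ ≤ Y ^ r := ENNReal.rpow_le_rpow h2 hr0.le

/-! ### The condition `B_{p,s}` -/

/-- The part of `A` that sees only large arguments. -/
noncomputable def youngCut (A : ℝ → ℝ) (u : ℝ≥0∞) : ℝ≥0∞ := youngExt A u - 2⁻¹

lemma youngCut_mono {A : ℝ → ℝ} (hA : OrliczFun A) : Monotone (youngCut A) :=
  fun _ _ h => tsub_le_tsub_right (youngExt_mono hA h) _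

lemma youngCut_measurable {A : ℝ → ℝ} (hA : OrliczFun A) : Measurable (youngCut A) :=
  (youngCut_mono hA).measurable

lemma youngCut_zero {A : ℝ → ℝ} (hA : OrliczFun A) : youngCut A 0 = 0 := by
  simp [youngCut, youngExt_zero hA]

/-- A(2^k) ≤ 2^k A(1) drops below 1/2 for very negative k. This is why the integral over t > 1 alone
suffices in B_{p,s}. -/
lemma youngCut_ofReal_eq_zero {A : ℝ → ℝ} (hA : OrliczFun A) :
    ∃ N : ℕ, ∀ k : ℤ, k < -N → youngCut A (ENNReal.ofReal ((2 : ℝ) ^ k)) = 0 := by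
  have h1 := hA.nonneg 1 zero_le_one
  obtain ⟨N, hN⟩ := exists_pow_lt_of_lt_one (show (0 : ℝ) < (2 * (A 1 + 1))⁻¹ by positivity)
    (show (1 / 2 : ℝ) < 1 by norm_num)
  refine ⟨N, fun k hk => ?_⟩
  have hk' : (2 : ℝ) ^ k ≤ (1 / 2 : ℝ) ^ N := by
    rw [one_div, inv_pow, ← zpow_natCast, ← zpow_neg]
    exact zpow_le_zpow_right₀ one_le_two hk.le
  have hpos : (0 : ℝ) < 2 ^ k := by positivity
  unfold youngCut youngExt
  rw [if_neg ENNReal.ofReal_ne_top, ENNReal.toReal_ofReal hpos.le, tsub_eq_zero_iff_le]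
  have e : (2⁻¹ : ℝ≥0∞) = ENNReal.ofReal 2⁻¹ := by
    rw [ENNReal.ofReal_inv_of_pos two_pos]; simp
  rw [e]
  refine ENNReal.ofReal_le_ofReal ?_
  have hlt := hk'.trans_lt hN
  have hle1 : (2 * (A 1 + 1))⁻¹ ≤ 1 := inv_le_one_of_one_le₀ (by linarith)
  have h3 := hA.star (2 ^ k) 1 hpos.le (hlt.le.trans hle1) zero_le_one
  rw [mul_one] at h3
  have h4 : (2 : ℝ) ^ k * (2 * (A 1 + 1)) ≤ 1 := by
    have := mul_le_mul_of_nonneg_right hlt.le (show (0 : ℝ) ≤ 2 * (A 1 + 1) by positivity)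
    rwa [inv_mul_cancel₀ (by positivity)] at this
  have h5 : (2 : ℝ) ^ k * A 1 ≤ 2⁻¹ := by nlinarith
  linarith

/-- The dyadic coefficients whose summability is the condition `B_{p,s}`. -/
noncomputable def bCoeff (A : ℝ → ℝ) (p s : ℝ) (k : ℤ) : ℝ≥0∞ :=
  (ENNReal.ofReal ((2 : ℝ) ^ (-(k : ℝ) * p)) * youngCut A (ENNReal.ofReal ((2 : ℝ) ^ k))) ^ (s / p)

/-- On (2^k, 2^{k+1}] the integrand is at least A(2^k)^{s/p} 2^{-(k+1)(s+1)}, and the interval has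
length 2^k; the mismatch is the factor 2^{s+1}. -/
lemma bCoeff_nat_le {A : ℝ → ℝ} (hA : OrliczFun A) {p s : ℝ} (hp : 0 < p) (hs : 0 < s) (k : ℕ) :
    bCoeff A p s k ≤ ENNReal.ofReal (2 ^ (s + 1)) *
      ∫⁻ t in Set.Ioc ((2 : ℝ) ^ k) (2 ^ (k + 1)),
        ENNReal.ofReal (A t ^ (s / p) / t ^ s * (1 / t)) := by
  have hpos : (0 : ℝ) < 2 ^ k := by positivity
  have hA0 : 0 ≤ A (2 ^ k) := hA.nonneg _ hpos.le
  have hlow : ∀ t ∈ Set.Ioc ((2 : ℝ) ^ k) (2 ^ (k + 1)),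
      A (2 ^ k) ^ (s / p) / (2 ^ (k + 1) : ℝ) ^ s * (1 / 2 ^ (k + 1)) ≤
        A t ^ (s / p) / t ^ s * (1 / t) := by
    intro t ht
    have ht0 : 0 < t := hpos.trans ht.1
    have h1 : A (2 ^ k) ≤ A t := hA.monotoneOn (Set.mem_Ici.2 hpos.le) (Set.mem_Ici.2 ht0.le) ht.1.le
    have h2 := ht.2
    have : 0 ≤ A t := hA0.trans h1
    gcongr
  have hint : ENNReal.ofReal (A (2 ^ k) ^ (s / p) / (2 ^ (k + 1) : ℝ) ^ s * (1 / 2 ^ (k + 1))) *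
      ENNReal.ofReal (2 ^ k) ≤ ∫⁻ t in Set.Ioc ((2 : ℝ) ^ k) (2 ^ (k + 1)),
        ENNReal.ofReal (A t ^ (s / p) / t ^ s * (1 / t)) := by
    calc _ = ∫⁻ t in Set.Ioc ((2 : ℝ) ^ k) (2 ^ (k + 1)),
        ENNReal.ofReal (A (2 ^ k) ^ (s / p) / (2 ^ (k + 1) : ℝ) ^ s * (1 / 2 ^ (k + 1))) := by
          rw [setLIntegral_const, Real.volume_Ioc]
          congr 2; ring
      _ ≤ _ := setLIntegral_mono' measurableSet_Ioc fun t ht =>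
          ENNReal.ofReal_le_ofReal (hlow t ht)
  refine le_trans ?_ (mul_le_mul' le_rfl hint)
  rw [← ENNReal.ofReal_mul (by positivity), ← ENNReal.ofReal_mul (by positivity)]
  unfold bCoeff
  calc _ ≤ (ENNReal.ofReal ((2 : ℝ) ^ (-((k : ℤ) : ℝ) * p)) * ENNReal.ofReal (A (2 ^ k))) ^ (s / p) := by
        gcongr
        refine tsub_le_self.trans (le_of_eq ?_)
        unfold youngExt
        rw [if_neg ENNReal.ofReal_ne_top, ENNReal.toReal_ofReal (by positivity), zpow_natCast]
    _ = ENNReal.ofReal (((2 : ℝ) ^ (-(k : ℝ) * p) * A (2 ^ k)) ^ (s / p)) := by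
        rw [← ENNReal.ofReal_mul (by positivity), ENNReal.ofReal_rpow_of_nonneg (by positivity)
          (by positivity)]
        simp
    _ = _ := by
        congr 1
        rw [Real.mul_rpow (by positivity) hA0, ← Real.rpow_mul zero_le_two]
        have e1 : ((2 : ℝ) ^ (k + 1)) ^ s = 2 ^ (k * s + s) := by
          rw [← Real.rpow_natCast, ← Real.rpow_mul zero_le_two]; push_cast; ring_nf
        have e2 : (2 : ℝ) ^ (-(k : ℝ) * p * (s / p)) = (2 ^ (k * s))⁻¹ := by
          rw [← Real.rpow_neg zero_le_two]; congr 1; field_simp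
        rw [e1, e2, Real.rpow_add two_pos, Real.rpow_add two_pos, Real.rpow_one, pow_succ]
        field_simp

lemma tsum_bCoeff_lt_top {A : ℝ → ℝ} (hA : OrliczFun A) {p s : ℝ} (hp : 0 < p) (hs : 0 < s)
    (hB : MemB A p s) : ∑' k : ℤ, bCoeff A p s k < ∞ := by
  have hfin : ∀ k, bCoeff A p s k < ∞ := fun k => by
    refine ENNReal.rpow_lt_top_of_nonneg (by positivity) (ENNReal.mul_ne_top ENNReal.ofReal_ne_top ?_)
    refine ne_top_of_le_ne_top ?_ tsub_le_self
    simp [youngExt]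
  obtain ⟨N, hN⟩ := youngCut_ofReal_eq_zero hA
  have hzero : ∀ k : ℤ, k < -N → bCoeff A p s k = 0 := fun k hk => by
    unfold bCoeff
    rw [hN k hk, mul_zero, ENNReal.zero_rpow_of_pos (by positivity)]
  rw [tsum_of_nat_of_neg_add_one ENNReal.summable ENNReal.summable, ENNReal.add_lt_top]
  constructor
  · have h1 : ∑' k : ℕ, bCoeff A p s k ≤ ENNReal.ofReal (2 ^ (s + 1)) *
        ∫⁻ t in Set.Ioi 1, ENNReal.ofReal (A t ^ (s / p) / t ^ s * (1 / t)) := by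
      calc ∑' k : ℕ, bCoeff A p s k ≤ ∑' k : ℕ, ENNReal.ofReal (2 ^ (s + 1)) *
          ∫⁻ t in Set.Ioc ((2 : ℝ) ^ k) (2 ^ (k + 1)),
            ENNReal.ofReal (A t ^ (s / p) / t ^ s * (1 / t)) :=
            ENNReal.tsum_le_tsum fun k => bCoeff_nat_le hA hp hs k
        _ = ENNReal.ofReal (2 ^ (s + 1)) * ∫⁻ t in ⋃ k : ℕ, Set.Ioc ((2 : ℝ) ^ k) (2 ^ (k + 1)),
            ENNReal.ofReal (A t ^ (s / p) / t ^ s * (1 / t)) := by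
            rw [ENNReal.tsum_mul_left, lintegral_iUnion (fun _ => measurableSet_Ioc)]
            exact (pow_right_mono₀ one_le_two).pairwise_disjoint_on_Ioc_succ
        _ ≤ _ := by
            gcongr
            refine Set.iUnion_subset fun k t ht => ?_
            exact lt_of_le_of_lt (one_le_pow₀ one_le_two) ht.1
    refine h1.trans_lt (ENNReal.mul_lt_top ENNReal.ofReal_lt_top ?_)
    refine lt_of_le_of_lt (lintegral_mono fun t => ?_) hB.2
    rw [← ofReal_norm]
    exact ENNReal.ofReal_le_ofReal (le_abs_self _)
  · rw [tsum_eq_sum (s := Finset.range N) fun n hn => ?_]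
    · exact ENNReal.sum_lt_top.2 fun n _ => hfin _
    · refine hzero _ ?_
      rw [Finset.mem_range, not_lt] at hn
      omega

/-- The pointwise dyadic form of `B_{p,s}`. -/
lemma sum_youngCut_le {A : ℝ → ℝ} (hA : OrliczFun A) {p s : ℝ} (hp : 0 < p) (hs : 0 < s)
    (u : ℝ≥0∞) (hu : u ≠ ∞) (J : Finset ℤ) :
    ∑ j ∈ J, (ENNReal.ofReal ((2 : ℝ) ^ ((j : ℝ) * p)) *
      youngCut A (u / ENNReal.ofReal ((2 : ℝ) ^ j))) ^ (s / p) ≤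
      (ENNReal.ofReal (2 ^ s) * ∑' k : ℤ, bCoeff A p s k) * u ^ s := by
  have hr : 0 < s / p := by positivity
  by_cases hu0 : u = 0
  · simp [hu0, youngCut_zero hA, hr]
  set x := u.toReal with hx
  have hx0 : 0 < x := ENNReal.toReal_pos hu0 hu
  have hux : u = ENNReal.ofReal x := (ENNReal.ofReal_toReal hu).symm
  -- With 2^m < u ≤ 2^{m+1}, the j-th term is at most 2^s u^s times the coefficient of index m + 1 -
  -- j, and j ↦ m + 1 - j permutes ℤ.
  obtain ⟨m, hm1, hm2⟩ := exists_mem_Ioc_zpow hx0 one_lt_two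
  have hterm : ∀ j : ℤ, (ENNReal.ofReal ((2 : ℝ) ^ ((j : ℝ) * p)) *
      youngCut A (u / ENNReal.ofReal ((2 : ℝ) ^ j))) ^ (s / p) ≤
      (ENNReal.ofReal (2 ^ s) * u ^ s) * bCoeff A p s (m + 1 - j) := by
    intro j
    have h1 : u / ENNReal.ofReal ((2 : ℝ) ^ j) ≤ ENNReal.ofReal (2 ^ (m + 1 - j)) := by
      rw [hux, ← ENNReal.ofReal_div_of_pos (by positivity)]
      refine ENNReal.ofReal_le_ofReal ?_
      rw [zpow_sub₀ two_ne_zero]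
      gcongr
    have h2 : ENNReal.ofReal ((2 : ℝ) ^ ((j : ℝ) * p)) =
        ENNReal.ofReal (2 ^ (((m : ℝ) + 1) * p)) *
          ENNReal.ofReal ((2 : ℝ) ^ (-((m + 1 - j : ℤ) : ℝ) * p)) := by
      rw [← ENNReal.ofReal_mul (by positivity), ← Real.rpow_add two_pos]
      congr 2; push_cast; ring
    have h3 : ENNReal.ofReal (2 ^ (((m : ℝ) + 1) * p)) ^ (s / p) ≤
        ENNReal.ofReal (2 ^ s) * u ^ s := by
      rw [hux, ENNReal.ofReal_rpow_of_nonneg (by positivity) (by positivity),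
        ENNReal.ofReal_rpow_of_nonneg (by positivity) (by positivity),
        ← ENNReal.ofReal_mul (by positivity), ← Real.rpow_mul zero_le_two]
      refine ENNReal.ofReal_le_ofReal ?_
      have : ((m : ℝ) + 1) * p * (s / p) = s + m * s := by field_simp; ring
      rw [this, Real.rpow_add two_pos, Real.rpow_mul zero_le_two, Real.rpow_intCast]
      gcongr
    rw [h2]
    unfold bCoeff
    calc _ ≤ (ENNReal.ofReal (2 ^ (((m : ℝ) + 1) * p)) *
          (ENNReal.ofReal ((2 : ℝ) ^ (-((m + 1 - j : ℤ) : ℝ) * p)) *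
          youngCut A (ENNReal.ofReal (2 ^ (m + 1 - j))))) ^ (s / p) := by
          rw [mul_assoc]
          gcongr
          exact youngCut_mono hA h1
      _ ≤ _ := by
          rw [ENNReal.mul_rpow_of_nonneg _ _ hr.le]
          gcongr
  calc _ ≤ ∑ j ∈ J, (ENNReal.ofReal (2 ^ s) * u ^ s) * bCoeff A p s (m + 1 - j) :=
        Finset.sum_le_sum fun j _ => hterm j
    _ = (ENNReal.ofReal (2 ^ s) * u ^ s) * ∑ j ∈ J, bCoeff A p s (m + 1 - j) := by
        rw [Finset.mul_sum]
    _ ≤ (ENNReal.ofReal (2 ^ s) * u ^ s) * ∑' k : ℤ, bCoeff A p s k := by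
        gcongr
        refine (ENNReal.sum_le_tsum J).trans ?_
        exact ((Equiv.subLeft (m + 1)).tsum_eq (fun k => bCoeff A p s k)).le
    _ = _ := by ring

/-! ### Nested families of sets -/

/-- A family of sets any two of which are nested or disjoint. -/
structure NestedFamily {d : ℕ} {ι : Type*} (Q : ι → Set (Rd d)) : Prop where
  injective : Function.Injective Q
  measurableSet : ∀ i, MeasurableSet (Q i)
  volume_ne_zero : ∀ i, volume (Q i) ≠ 0
  volume_ne_top : ∀ i, volume (Q i) ≠ ∞
  nested : ∀ i j, Q i ⊆ Q j ∨ Q j ⊆ Q i ∨ Disjoint (Q i) (Q j)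

section nested
variable {d : ℕ} {ι : Type*} {Q : ι → Set (Rd d)}

/-- The maximal members of a finite family. -/
lemma exists_maximal_subfamily (hQ : NestedFamily Q) (T : Finset ι) :
    ∃ M ⊆ T, (M : Set ι).PairwiseDisjoint Q ∧ ∀ i ∈ T, ∃ j ∈ M, Q i ⊆ Q j := by
  classical
  refine ⟨T.filter fun i => ∀ j ∈ T, Q i ⊆ Q j → Q j ⊆ Q i, Finset.filter_subset _ _, ?_, ?_⟩
  · intro i hi j hj hij
    simp only [Finset.coe_filter, Set.mem_ofPred_eq] at hi hj
    rcases hQ.nested i j with h | h | h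
    · exact absurd (hQ.injective (h.antisymm (hi.2 j hj.1 h))) hij
    · exact absurd (hQ.injective ((hj.2 i hi.1 h).antisymm h)) hij
    · exact h
  · intro i hi
    obtain ⟨b, hib, hb⟩ := (T.finite_toSet.image Q).exists_le_maximal (Set.mem_image_of_mem Q hi)
    obtain ⟨j, hj, rfl⟩ := hb.1
    refine ⟨j, Finset.mem_filter.2 ⟨hj, fun k hk hjk => ?_⟩, hib⟩
    exact hb.2 (Set.mem_image_of_mem Q hk) hjk

lemma sum_lintegral_le (hQ : NestedFamily Q) {M : Finset ι} (hM : (M : Set ι).PairwiseDisjoint Q)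
    (R : Set (Rd d)) (hR : ∀ i ∈ M, Q i ⊆ R) (F : Rd d → ℝ≥0∞) :
    ∑ i ∈ M, ∫⁻ x in Q i, F x ≤ ∫⁻ x in R, F x := by
  rw [← lintegral_biUnion_finset hM (fun i _ => hQ.measurableSet i)]
  exact lintegral_mono_set (Set.iUnion₂_subset hR)

lemma sum_volume_le (hQ : NestedFamily Q) {M : Finset ι} (hM : (M : Set ι).PairwiseDisjoint Q)
    (R : Set (Rd d)) (hR : ∀ i ∈ M, Q i ⊆ R) :
    ∑ i ∈ M, volume (Q i) ≤ volume R := by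
  simpa using sum_lintegral_le hQ hM R hR (fun _ => 1)

/-- The members on which a Luxemburg norm is large fill a small part of `R`. -/
lemma sum_volume_le_of_orliczNorm_lt (hQ : NestedFamily Q) {A : ℝ → ℝ} (hA : OrliczFun A)
    {g : Rd d → ℝ≥0∞} (hg : ∀ x, g x ≠ ∞) {M : Finset ι} (hM : (M : Set ι).PairwiseDisjoint Q)
    (R : ι) (hR : ∀ i ∈ M, Q i ⊆ Q R) (hR0 : orliczNorm A (Q R) g ≠ 0) (n : ℕ)
    (hlt : ∀ i ∈ M, 2 ^ (n + 1) * orliczNorm A (Q R) g < orliczNorm A (Q i) g) :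
    ∑ i ∈ M, volume (Q i) ≤ volume (Q R) / 2 ^ n := by
  rcases M.eq_empty_or_nonempty with rfl | ⟨i0, hi0⟩
  · simp
  have hRT : orliczNorm A (Q R) g ≠ ∞ := by
    intro h
    have := hlt i0 hi0
    rw [h, ENNReal.mul_top (by positivity)] at this
    exact not_top_lt this
  lift orliczNorm A (Q R) g to ℝ≥0 using hRT with G hG
  have hG0 : 0 < G := by
    rw [pos_iff_ne_zero]; exact_mod_cast hR0
  -- The level 2G lies strictly above the norm G; this uses one of the n + 1 factors 2.
  -- Starshapedness turns the other n into the gain 2^{-n}.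
  have h2 : ∫⁻ x in Q R, youngExt A (g x / (2 * G : ℝ≥0)) ≤ volume (Q R) := by
    refine lintegral_le_of_orliczNorm_lt hA (hQ.volume_ne_zero R) (hQ.volume_ne_top R) ?_
    rw [← hG]
    exact_mod_cast (by rw [two_mul]; exact lt_add_of_pos_left G hG0 : G < 2 * G)
  calc ∑ i ∈ M, volume (Q i)
      ≤ ∑ i ∈ M, ∫⁻ x in Q i, youngExt A (g x / (2 ^ (n + 1) * G : ℝ≥0)) := by
        refine Finset.sum_le_sum fun i hi => (lt_lintegral_of_lt_orliczNorm (hQ.volume_ne_zero i)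
          (hQ.volume_ne_top i) (by positivity) ?_).le
        exact_mod_cast hlt i hi
    _ ≤ ∫⁻ x in Q R, youngExt A (g x / (2 ^ (n + 1) * G : ℝ≥0)) := sum_lintegral_le hQ hM _ hR _
    _ ≤ ∫⁻ x in Q R, ((2 ^ n)⁻¹ : ℝ≥0) * youngExt A (g x / (2 * G : ℝ≥0)) := by
        refine lintegral_mono fun x => ?_
        refine le_trans (le_of_eq ?_) (youngExt_mul_le hA ((2 ^ n)⁻¹ : ℝ≥0) ?_ _ ?_)
        · congr 1
          rw [pow_succ, mul_assoc, ENNReal.coe_mul, ENNReal.coe_inv (by positivity),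
            ENNReal.div_eq_inv_mul, ENNReal.div_eq_inv_mul, ENNReal.mul_inv (Or.inr (by finiteness))
              (Or.inl (by finiteness)), mul_assoc]
        · exact inv_le_one_of_one_le₀ (one_le_pow₀ one_le_two)
        · exact ENNReal.div_ne_top (hg x) (by exact_mod_cast (by positivity : (2 * G) ≠ 0))
    _ = ((2 ^ n)⁻¹ : ℝ≥0) * ∫⁻ x in Q R, youngExt A (g x / (2 * G : ℝ≥0)) := by
        rw [lintegral_const_mul' _ _ ENNReal.coe_ne_top]
    _ ≤ ((2 ^ n)⁻¹ : ℝ≥0) * volume (Q R) := by gcongr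
    _ = _ := by
        rw [ENNReal.coe_inv (by positivity), ENNReal.div_eq_inv_mul]
        simp

/-- A finite nested sum is dominated by the sum over a sparse subfamily. -/
lemma exists_sparse_subfamily (hQ : NestedFamily Q) (T : Finset ι) (G H : ι → ℝ) {δ C : ℝ}
    (hδ : 0 < δ) (hG : ∀ i ∈ T, 0 < G i) (hH : ∀ i ∈ T, 0 < H i)
    (hGs : ∀ (R : ι) (n : ℕ) (M : Finset ι), R ∈ T → M ⊆ T → (M : Set ι).PairwiseDisjoint Q →
      (∀ i ∈ M, Q i ⊆ Q R) → (∀ i ∈ M, 2 ^ (n + 1) * G R < G i) →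
      ∑ i ∈ M, (volume (Q i)).toReal ≤ (volume (Q R)).toReal / 2 ^ n)
    (hHs : ∀ (R : ι) (n : ℕ) (M : Finset ι), R ∈ T → M ⊆ T → (M : Set ι).PairwiseDisjoint Q →
      (∀ i ∈ M, Q i ⊆ Q R) → (∀ i ∈ M, 2 ^ (n + 1) * H R < H i) →
      ∑ i ∈ M, (volume (Q i)).toReal ≤ (volume (Q R)).toReal / 2 ^ n)
    (hC : ∀ R ∈ T, ∀ M ⊆ T, (∀ i ∈ M, Q i ⊆ Q R) →
      ∑ i ∈ M, (volume (Q i)).toReal ^ (1 + δ) ≤ C * (volume (Q R)).toReal ^ (1 + δ)) :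
    ∃ D ⊆ T, (∑ i ∈ T, (volume (Q i)).toReal ^ (1 + 2 * δ) * (G i * H i) ≤
        4 * C * ∑ i ∈ D, (volume (Q i)).toReal ^ (1 + 2 * δ) * (G i * H i)) ∧
      ∀ R ∈ D, ∀ M ⊆ D, (∀ i ∈ M, Q i ⊆ Q R) →
        ∑ i ∈ M, (volume (Q i)).toReal ≤ 16 * (volume (Q R)).toReal := by
  classical
  set v : ι → ℝ := fun i => (volume (Q i)).toReal with hv
  have hv0 : ∀ i, 0 < v i := fun i => ENNReal.toReal_pos (hQ.volume_ne_zero i) (hQ.volume_ne_top i)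
  have hvmono : ∀ i j, Q i ⊆ Q j → v i ≤ v j := fun i j h =>
    ENNReal.toReal_mono (hQ.volume_ne_top j) (measure_mono h)
  have hdisj : ∀ (R : ι) (M : Finset ι), (M : Set ι).PairwiseDisjoint Q →
      (∀ i ∈ M, Q i ⊆ Q R) → ∑ i ∈ M, v i ≤ v R := by
    intro R M hM hMR
    have := ENNReal.toReal_mono (hQ.volume_ne_top R) (sum_volume_le hQ hM _ hMR)
    rwa [ENNReal.toReal_sum fun i _ => hQ.volume_ne_top i] at this
  -- The score takes one δ of the excess exponent; the remaining weight v^{1+δ} is summable inside a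
  -- fixed set by `hC`.
  set m : ι → ℝ := fun i => v i ^ δ * (G i * H i) with hm
  have hm0 : ∀ i ∈ T, 0 < m i := fun i hi =>
    mul_pos (Real.rpow_pos_of_pos (hv0 i) _) (mul_pos (hG i hi) (hH i hi))
  -- Base 4 = 2 · 2: growth of the product G H by 4^k forces growth of G or of H by 2^k.
  have hlev : ∀ i, ∃ l : ℤ, i ∈ T → (4 : ℝ) ^ l < m i ∧ m i ≤ 4 ^ (l + 1) := by
    intro i
    by_cases hi : i ∈ T
    · obtain ⟨l, hl⟩ := exists_mem_Ioc_zpow (hm0 i hi) (show (1 : ℝ) < 4 by norm_num)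
      exact ⟨l, fun _ => hl⟩
    · exact ⟨0, fun h => absurd h hi⟩
  choose L hL using hlev
  have hv2 : ∀ i, v i ^ (1 + 2 * δ) * (G i * H i) = v i ^ (1 + δ) * m i := by
    intro i
    rw [show 1 + 2 * δ = (1 + δ) + δ by ring, Real.rpow_add (hv0 i), mul_assoc]
  set D := T.filter fun R => ∀ R' ∈ T, Q R ⊂ Q R' → L R' < L R with hD
  have hDT : D ⊆ T := Finset.filter_subset _ _
  -- Among the sets containing `Q i` at no lower level, take the highest level and then a maximal
  -- set at that level. Any strictly larger set must then have a strictly lower level.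
  have hcover : ∀ i ∈ T, ∃ R ∈ D, Q i ⊆ Q R ∧ L i ≤ L R := by
    intro i hi
    set S := T.filter fun R => Q i ⊆ Q R ∧ L i ≤ L R with hS
    have hSi : i ∈ S := Finset.mem_filter.2 ⟨hi, subset_rfl, le_rfl⟩
    obtain ⟨R1, hR1S, hR1⟩ := S.exists_max_image L ⟨i, hSi⟩
    set S' := S.filter fun R => L R = L R1 with hS'
    obtain ⟨_, ⟨R2, hR2S, rfl⟩, hR2⟩ := (S'.finite_toSet.image Q).exists_maximal
      ⟨Q R1, Set.mem_image_of_mem Q (Finset.mem_filter.2 ⟨hR1S, rfl⟩)⟩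
    have h2 := Finset.mem_filter.1 hR2S
    have h3 := Finset.mem_filter.1 h2.1
    refine ⟨R2, Finset.mem_filter.2 ⟨h3.1, fun R' hR' hlt => ?_⟩, h3.2⟩
    by_contra hcon
    rw [not_lt] at hcon
    have hR'S : R' ∈ S := Finset.mem_filter.2 ⟨hR', h3.2.1.trans hlt.1, h3.2.2.trans hcon⟩
    have hR'S' : R' ∈ S' := by
      refine Finset.mem_filter.2 ⟨hR'S, le_antisymm (hR1 R' hR'S) ?_⟩
      rw [← h2.2]; exact hcon
    exact hlt.2 (hR2 (Set.mem_image_of_mem Q hR'S') hlt.1)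
  refine ⟨D, hDT, ?_, ?_⟩
  · choose! P hPD hP using hcover
    have h1 : ∑ i ∈ T, v i ^ (1 + δ) * m i = ∑ R ∈ D, ∑ i ∈ T with P i = R, v i ^ (1 + δ) * m i :=
      (Finset.sum_fiberwise_of_maps_to hPD _).symm
    change ∑ i ∈ T, v i ^ (1 + 2 * δ) * (G i * H i) ≤
      4 * C * ∑ i ∈ D, v i ^ (1 + 2 * δ) * (G i * H i)
    simp only [hv2]
    rw [h1, Finset.mul_sum]
    refine Finset.sum_le_sum fun R hR => ?_
    have hRT := hDT hR
    calc ∑ i ∈ T with P i = R, v i ^ (1 + δ) * m i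
        ≤ ∑ i ∈ T with P i = R, v i ^ (1 + δ) * (4 * m R) := by
          refine Finset.sum_le_sum fun i hi => ?_
          obtain ⟨hiT, rfl⟩ := Finset.mem_filter.1 hi
          have : m i ≤ 4 * m (P i) := by
            calc m i ≤ 4 ^ (L i + 1) := (hL i hiT).2
              _ ≤ 4 ^ (L (P i) + 1) := zpow_le_zpow_right₀ (by norm_num) (by linarith [(hP i hiT).2])
              _ = 4 * 4 ^ L (P i) := by rw [zpow_add₀ (by norm_num)]; ring
              _ ≤ _ := by gcongr; exact (hL _ hRT).1.le
          have := hv0 i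
          gcongr
      _ = (∑ i ∈ T with P i = R, v i ^ (1 + δ)) * (4 * m R) := by rw [Finset.sum_mul]
      _ ≤ (C * v R ^ (1 + δ)) * (4 * m R) := by
          have := hm0 R hRT
          gcongr
          refine hC R hRT _ (Finset.filter_subset _ _) fun i hi => ?_
          obtain ⟨hiT, rfl⟩ := Finset.mem_filter.1 hi
          exact (hP i hiT).1
      _ = _ := by ring
  · intro R hR M hM hMR
    have hRT := hDT hR
    have hlvl : ∀ i ∈ M, L R ≤ L i := by
      intro i hi
      by_cases h : Q R ⊆ Q i
      · rw [hQ.injective ((hMR i hi).antisymm h)]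
      · exact ((Finset.mem_filter.1 (hM hi)).2 R hRT ⟨hMR i hi, h⟩).le
    set N : ι → ℕ := fun i => (L i - L R).toNat with hN
    have hNi : ∀ i ∈ M, L i = L R + N i := fun i hi => by
      have := hlvl i hi
      simp only [hN]; omega
    -- Strict nesting inside `D` raises the level strictly, so sets of equal level cannot be nested.
    have hpd : ∀ n : ℕ, ((M.filter fun i => N i = n : Finset ι) : Set ι).PairwiseDisjoint Q := by
      intro n i hi j hj hij
      obtain ⟨hi, hin⟩ := Finset.mem_filter.1 (Finset.mem_coe.1 hi)
      obtain ⟨hj, hjn⟩ := Finset.mem_filter.1 (Finset.mem_coe.1 hj)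
      have hLij : L i = L j := by rw [hNi i hi, hNi j hj, hin, hjn]
      rcases hQ.nested i j with h | h | h
      · have := (Finset.mem_filter.1 (hM hi)).2 j (hDT (hM hj))
          ⟨h, fun h' => hij (hQ.injective (h.antisymm h'))⟩
        omega
      · have := (Finset.mem_filter.1 (hM hj)).2 i (hDT (hM hi))
          ⟨h, fun h' => hij (hQ.injective (h'.antisymm h))⟩
        omega
      · exact h
    -- For n < 2 disjointness suffices. For n = k + 2, one level is lost to rounding of m(R), so m
    -- grows by more than 4^{k+1}; each set then falls under `hGs` or `hHs`, and 2 v_R / 2^k = 8 v_R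
    -- / 2^n.
    have hlevel : ∀ n : ℕ, ∑ i ∈ M with N i = n, v i ≤ 8 * v R * (1 / 2) ^ n := by
      intro n
      have hsub : ∀ i ∈ M.filter fun i => N i = n, Q i ⊆ Q R := fun i hi =>
        hMR i (Finset.mem_filter.1 hi).1
      rcases Nat.lt_or_ge n 2 with hn | hn
      · refine (hdisj R _ (hpd n) hsub).trans ?_
        have := hv0 R
        interval_cases n <;> norm_num <;> linarith
      · obtain ⟨k, rfl⟩ := Nat.exists_eq_add_of_le' hn
        set F := M.filter fun i => N i = k + 2 with hF
        have hFT : F ⊆ T := (Finset.filter_subset _ _).trans (hM.trans hDT)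
        have hor : ∀ i ∈ F, 2 ^ (k + 1) * G R < G i ∨ 2 ^ (k + 1) * H R < H i := by
          intro i hi
          by_contra! hcon
          obtain ⟨hiM, hin⟩ := Finset.mem_filter.1 hi
          have hiT := hFT hi
          have h1 : (4 : ℝ) ^ (L R + 1) * 4 ^ (k + 1) < m i := by
            refine lt_of_eq_of_lt ?_ (hL i hiT).1
            rw [hNi i hiM, hin, ← zpow_natCast, ← zpow_add₀ (by norm_num)]
            congr 1; push_cast; ring
          have h2 : m R * 4 ^ (k + 1) < m i :=
            lt_of_le_of_lt (by gcongr; exact (hL R hRT).2) h1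
          have h3 : m i ≤ v R ^ δ * ((2 ^ (k + 1) * G R) * (2 ^ (k + 1) * H R)) := by
            have a1 := (hG i hiT).le
            have a2 := (hH i hiT).le
            have a3 := (hv0 i).le
            have a4 := hvmono i R (hMR i hiM)
            have a5 := (hG R hRT).le
            have a6 := (hv0 R).le
            simp only [hm]
            gcongr
            · exact hcon.1
            · exact hcon.2
          have h4 : v R ^ δ * ((2 ^ (k + 1) * G R) * (2 ^ (k + 1) * H R)) = m R * 4 ^ (k + 1) := by
            simp only [hm]
            rw [show (4 : ℝ) = 2 * 2 by norm_num, mul_pow]; ring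
          linarith
        have hsplit : ∑ i ∈ F, v i ≤ ∑ i ∈ F with 2 ^ (k + 1) * G R < G i, v i +
            ∑ i ∈ F with 2 ^ (k + 1) * H R < H i, v i := by
          rw [← Finset.sum_filter_add_sum_filter_not F (fun i => 2 ^ (k + 1) * G R < G i)]
          refine add_le_add le_rfl ?_
          refine Finset.sum_le_sum_of_subset_of_nonneg (fun i hi => ?_) fun i _ _ => (hv0 i).le
          obtain ⟨hi, hn⟩ := Finset.mem_filter.1 hi
          exact Finset.mem_filter.2 ⟨hi, (hor i hi).resolve_left hn⟩
        have e1 := hGs R k (F.filter fun i => 2 ^ (k + 1) * G R < G i) hRT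
          ((Finset.filter_subset _ _).trans hFT)
          ((hpd _).subset (by exact_mod_cast Finset.filter_subset _ _))
          (fun i hi => hsub i (Finset.mem_filter.1 hi).1) (fun i hi => (Finset.mem_filter.1 hi).2)
        have e2 := hHs R k (F.filter fun i => 2 ^ (k + 1) * H R < H i) hRT
          ((Finset.filter_subset _ _).trans hFT)
          ((hpd _).subset (by exact_mod_cast Finset.filter_subset _ _))
          (fun i hi => hsub i (Finset.mem_filter.1 hi).1) (fun i hi => (Finset.mem_filter.1 hi).2)
        refine hsplit.trans ((add_le_add e1 e2).trans (le_of_eq ?_))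
        simp only [hv]
        rw [one_div, inv_pow, pow_add]
        field_simp
        ring
    calc ∑ i ∈ M, v i = ∑ n ∈ M.image N, ∑ i ∈ M with N i = n, v i :=
          (Finset.sum_fiberwise_of_maps_to (fun i hi => Finset.mem_image_of_mem N hi) _).symm
      _ ≤ ∑ n ∈ M.image N, 8 * v R * (1 / 2) ^ n := Finset.sum_le_sum fun n _ => hlevel n
      _ = 8 * v R * ∑ n ∈ M.image N, (1 / 2 : ℝ) ^ n := by rw [Finset.mul_sum]
      _ ≤ 8 * v R * 2 := by
          have := hv0 R
          gcongr
          refine le_trans ?_ tsum_geometric_two.le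
          exact summable_geometric_two.sum_le_tsum _ fun _ _ => by positivity
      _ = 16 * v R := by ring
end nested

/-! ### Carleson embedding and the bilinear sum over a nested family -/

section nested
variable {d : ℕ} {ι : Type*} {Q : ι → Set (Rd d)}

/-- The average of A(g/l) exceeds 1, so subtracting 1/2 still leaves an average of at least 1/2.
Small values of g are discarded, which makes the later sum over levels converge. -/
lemma volume_le_lintegral_youngCut {A : ℝ → ℝ} {R : Set (Rd d)} {g : Rd d → ℝ≥0∞}
    (h0 : volume R ≠ 0) (hT : volume R ≠ ∞) {l : ℝ≥0} (hl : 0 < l)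
    (h : l < orliczNorm A R g) :
    volume R ≤ 2 * ∫⁻ x in R, youngCut A (g x / l) := by
  have h1 := lt_lintegral_of_lt_orliczNorm h0 hT hl h
  have h2 : ∫⁻ x in R, youngExt A (g x / l) ≤
      (∫⁻ x in R, youngCut A (g x / l)) + 2⁻¹ * volume R := by
    calc _ ≤ ∫⁻ x in R, (youngCut A (g x / l) + 2⁻¹) :=
          lintegral_mono fun x => le_tsub_add
      _ = _ := by rw [lintegral_add_right _ measurable_const]; simp
  have h3 : volume R = 2⁻¹ * volume R + 2⁻¹ * volume R := by
    rw [← add_mul, ENNReal.inv_two_add_inv_two, one_mul]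
  have h4 : 2⁻¹ * volume R + 2⁻¹ * volume R ≤
      (∫⁻ x in R, youngCut A (g x / l)) + 2⁻¹ * volume R := by
    rw [← h3]; exact h1.le.trans h2
  have h5 : 2⁻¹ * volume R ≤ ∫⁻ x in R, youngCut A (g x / l) :=
    (ENNReal.add_le_add_iff_right (ENNReal.mul_ne_top (by simp) hT)).1 h4
  calc volume R = 2 * (2⁻¹ * volume R) := by
        rw [← mul_assoc, ENNReal.mul_inv_cancel two_ne_zero ENNReal.ofNat_ne_top, one_mul]
    _ ≤ _ := by gcongr

/-- The Carleson embedding for Luxemburg norms over a sparse family. -/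
lemma carleson_embedding (hQ : NestedFamily Q) {A : ℝ → ℝ} (hA : OrliczFun A) {p s : ℝ}
    (hp : 0 < p) (hps : p ≤ s) {g : Rd d → ℝ≥0∞} (hg : Measurable g) (hgT : ∀ x, g x ≠ ∞)
    (D : Finset ι)
    (hD : ∀ R ∈ D, ∀ M ⊆ D, (∀ i ∈ M, Q i ⊆ Q R) →
      ∑ i ∈ M, volume (Q i) ≤ 16 * volume (Q R))
    (hG0 : ∀ R ∈ D, orliczNorm A (Q R) g ≠ 0) (hGT : ∀ R ∈ D, orliczNorm A (Q R) g ≠ ∞) :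
    ∑ R ∈ D, volume (Q R) ^ (s / p) * orliczNorm A (Q R) g ^ s ≤
      ENNReal.ofReal (2 ^ s) * 32 ^ (s / p) * (ENNReal.ofReal (2 ^ s) * ∑' k : ℤ, bCoeff A p s k) *
        (∫⁻ x, g x ^ p) ^ (s / p) := by
  classical
  have hs : 0 < s := hp.trans_le hps
  have hr : 1 ≤ s / p := (one_le_div hp).2 hps
  have hr0 : 0 < s / p := by positivity
  have hlev : ∀ R, ∃ j : ℤ, R ∈ D → ENNReal.ofReal (2 ^ j) < orliczNorm A (Q R) g ∧
      orliczNorm A (Q R) g ≤ ENNReal.ofReal (2 ^ (j + 1)) := by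
    intro R
    by_cases hR : R ∈ D
    · obtain ⟨j, hj1, hj2⟩ := exists_mem_Ioc_zpow (ENNReal.toReal_pos (hG0 R hR) (hGT R hR))
        one_lt_two
      exact ⟨j, fun _ => ⟨(ENNReal.ofReal_lt_iff_lt_toReal (by positivity) (hGT R hR)).2 hj1,
        (ENNReal.le_ofReal_iff_toReal_le (hGT R hR) (by positivity)).2 hj2⟩⟩
    · exact ⟨0, fun h => absurd h hR⟩
  choose J hJ using hlev
  -- Packing reduces to the maximal sets of level j at the cost 16; these are disjoint, and each
  -- costs a further factor 2.
  have hlevel : ∀ j : ℤ, ∑ R ∈ D with J R = j, volume (Q R) ≤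
      32 * ∫⁻ x, youngCut A (g x / ENNReal.ofReal (2 ^ j)) := by
    intro j
    set Dj := D.filter fun R => J R = j with hDj
    have hDjD : Dj ⊆ D := Finset.filter_subset _ _
    obtain ⟨M, hMD, hMd, hMc⟩ := exists_maximal_subfamily hQ Dj
    choose! P hPM hP using hMc
    have hvol : ∀ R ∈ M, volume (Q R) ≤
        2 * ∫⁻ x in Q R, youngCut A (g x / ENNReal.ofReal (2 ^ j)) := by
      intro R hR
      obtain ⟨hRD, hRj⟩ := Finset.mem_filter.1 (hMD hR)
      refine volume_le_lintegral_youngCut (hQ.volume_ne_zero R) (hQ.volume_ne_top R)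
        (by rw [Real.toNNReal_pos]; positivity) ?_
      have := (hJ R hRD).1
      rwa [hRj] at this
    calc ∑ R ∈ Dj, volume (Q R)
        = ∑ S ∈ M, ∑ R ∈ Dj with P R = S, volume (Q R) :=
          (Finset.sum_fiberwise_of_maps_to hPM _).symm
      _ ≤ ∑ S ∈ M, 16 * volume (Q S) := by
          refine Finset.sum_le_sum fun S hS => hD S (hDjD (hMD hS)) _
            ((Finset.filter_subset _ _).trans hDjD) fun i hi => ?_
          obtain ⟨hi1, rfl⟩ := Finset.mem_filter.1 hi
          exact hP i hi1
      _ ≤ ∑ S ∈ M, 16 * (2 * ∫⁻ x in Q S, youngCut A (g x / ENNReal.ofReal (2 ^ j))) := by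
          refine Finset.sum_le_sum fun S hS => ?_
          gcongr
          exact hvol S hS
      _ = 32 * ∑ S ∈ M, ∫⁻ x in Q S, youngCut A (g x / ENNReal.ofReal (2 ^ j)) := by
          rw [Finset.mul_sum]
          refine Finset.sum_congr rfl fun S _ => ?_
          rw [← mul_assoc]; norm_num
      _ ≤ _ := by
          gcongr
          refine (sum_lintegral_le hQ hMd Set.univ (fun _ _ => Set.subset_univ _) _).trans ?_
          rw [Measure.restrict_univ]
  have hmeas : ∀ j : ℤ, Measurable fun x => youngCut A (g x / ENNReal.ofReal (2 ^ j)) :=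
    fun j => (youngCut_measurable hA).comp (hg.div_const _)
  calc ∑ R ∈ D, volume (Q R) ^ (s / p) * orliczNorm A (Q R) g ^ s
      = ∑ j ∈ D.image J, ∑ R ∈ D with J R = j, volume (Q R) ^ (s / p) *
          orliczNorm A (Q R) g ^ s :=
        (Finset.sum_fiberwise_of_maps_to (fun i hi => Finset.mem_image_of_mem J hi) _).symm
    _ ≤ ∑ j ∈ D.image J, ENNReal.ofReal (2 ^ s) * 32 ^ (s / p) *
          (∫⁻ x, ENNReal.ofReal ((2 : ℝ) ^ ((j : ℝ) * p)) *
            youngCut A (g x / ENNReal.ofReal (2 ^ j))) ^ (s / p) := by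
        refine Finset.sum_le_sum fun j _ => ?_
        have e : ENNReal.ofReal (2 ^ (j + 1)) ^ s =
            ENNReal.ofReal (2 ^ s) * ENNReal.ofReal ((2 : ℝ) ^ ((j : ℝ) * p)) ^ (s / p) := by
          rw [ENNReal.ofReal_rpow_of_nonneg (by positivity) hs.le,
            ENNReal.ofReal_rpow_of_nonneg (by positivity) hr0.le,
            ← ENNReal.ofReal_mul (by positivity), ← Real.rpow_mul zero_le_two,
            ← Real.rpow_intCast, ← Real.rpow_mul zero_le_two, ← Real.rpow_add two_pos]
          congr 2
          push_cast
          field_simp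
          ring
        calc ∑ R ∈ D with J R = j, volume (Q R) ^ (s / p) * orliczNorm A (Q R) g ^ s
            ≤ ∑ R ∈ D with J R = j, volume (Q R) ^ (s / p) * ENNReal.ofReal (2 ^ (j + 1)) ^ s := by
              refine Finset.sum_le_sum fun R hR => ?_
              obtain ⟨hRD, rfl⟩ := Finset.mem_filter.1 hR
              gcongr
              exact (hJ R hRD).2
          _ = (∑ R ∈ D with J R = j, volume (Q R) ^ (s / p)) * ENNReal.ofReal (2 ^ (j + 1)) ^ s := by
              rw [Finset.sum_mul]
          _ ≤ (32 * ∫⁻ x, youngCut A (g x / ENNReal.ofReal (2 ^ j))) ^ (s / p) *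
              ENNReal.ofReal (2 ^ (j + 1)) ^ s := by
              gcongr
              -- Here p ≤ s enters: for s/p ≥ 1 the sum of the powers is at most the power of the
              -- sum.
              exact (sum_rpow_le_rpow_sum _ _ hr).trans (ENNReal.rpow_le_rpow (hlevel j) hr0.le)
          _ = _ := by
              rw [e, lintegral_const_mul _ (hmeas j), ENNReal.mul_rpow_of_nonneg _ _ hr0.le,
                ENNReal.mul_rpow_of_nonneg _ _ hr0.le]
              ring
    _ = ENNReal.ofReal (2 ^ s) * 32 ^ (s / p) * ∑ j ∈ D.image J,
          (∫⁻ x, ENNReal.ofReal ((2 : ℝ) ^ ((j : ℝ) * p)) *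
            youngCut A (g x / ENNReal.ofReal (2 ^ j))) ^ (s / p) := by rw [Finset.mul_sum]
    _ ≤ ENNReal.ofReal (2 ^ s) * 32 ^ (s / p) *
          (∫⁻ x, ((ENNReal.ofReal (2 ^ s) * ∑' k : ℤ, bCoeff A p s k) * g x ^ s) ^
            (1 / (s / p))) ^ (s / p) := by
        gcongr
        -- Minkowski brings the sum over levels under the integral, where B_{p,s} acts at each
        -- point.
        refine (sum_lintegral_rpow_le volume _ _ (fun j _ => (hmeas j).const_mul _) hr).trans ?_
        gcongr with x
        exact sum_youngCut_le hA hp hs (g x) (hgT x) _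
    _ = _ := by
        have e : ∀ x, ((ENNReal.ofReal (2 ^ s) * ∑' k : ℤ, bCoeff A p s k) * g x ^ s) ^
            (1 / (s / p)) = (ENNReal.ofReal (2 ^ s) * ∑' k : ℤ, bCoeff A p s k) ^ (1 / (s / p)) *
            g x ^ p := by
          intro x
          rw [ENNReal.mul_rpow_of_nonneg _ _ (by positivity), ← ENNReal.rpow_mul]
          congr 2
          field_simp
        simp only [e]
        rw [lintegral_const_mul _ (hg.pow_const _), ENNReal.mul_rpow_of_nonneg _ _ hr0.le,
          ← ENNReal.rpow_mul, one_div_mul_cancel hr0.ne', ENNReal.rpow_one]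
        ring

/-- The bilinear sum over a nested family, for functions with finite Luxemburg norms. -/
lemma nested_sum_le (hQ : NestedFamily Q) {A B : ℝ → ℝ} (hA : OrliczFun A) (hB : OrliczFun B)
    {p q s : ℝ} (hp : 1 < p) (hps : p ≤ s) (hsq : s ≤ q) (hpq : p < q)
    {C : ℝ} (hC0 : 0 ≤ C)
    (hC : ∀ (R : ι) (M : Finset ι), (∀ i ∈ M, Q i ⊆ Q R) →
      ∑ i ∈ M, (volume (Q i)).toReal ^ (1 + (1 / p - 1 / q) / 2) ≤
        C * (volume (Q R)).toReal ^ (1 + (1 / p - 1 / q) / 2))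
    {g h : Rd d → ℝ≥0∞} (hg : Measurable g) (hh : Measurable h) (N : ℝ≥0)
    (hgN : ∀ x, g x ≤ N) (hhN : ∀ x, h x ≤ N) (T : Finset ι) :
    ∑ i ∈ T, volume (Q i) ^ (1 + (1 / p - 1 / q)) * (orliczNorm A (Q i) g * orliczNorm B (Q i) h) ≤
      ENNReal.ofReal (4 * C) *
      ((ENNReal.ofReal (2 ^ s) * 32 ^ (s / p) *
        (ENNReal.ofReal (2 ^ s) * ∑' k : ℤ, bCoeff A p s k)) ^ (1 / s) *
      (ENNReal.ofReal (2 ^ (s / (s - 1))) * 32 ^ (s / (s - 1) / (q / (q - 1))) *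
        (ENNReal.ofReal (2 ^ (s / (s - 1))) *
          ∑' k : ℤ, bCoeff B (q / (q - 1)) (s / (s - 1)) k)) ^ (1 / (s / (s - 1)))) *
      ((∫⁻ x, g x ^ p) ^ (1 / p) * (∫⁻ x, h x ^ (q / (q - 1))) ^ (1 / (q / (q - 1)))) := by
  classical
  have hs1 : 1 < s := hp.trans_le hps
  have hq1 : 1 < q := hp.trans hpq
  have hp0 : 0 < p := by linarith
  have hq0 : 0 < q := by linarith
  have hs0 : 0 < s := by linarith
  set q' := q / (q - 1) with hq'
  set s' := s / (s - 1) with hs'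
  have hconj : s.HolderConjugate s' := Real.HolderConjugate.conjExponent hs1
  have hq'0 : 0 < q' := div_pos hq0 (by linarith)
  have hs'0 : 0 < s' := div_pos hs0 (by linarith)
  -- The embedding for h has exponents (q', s'), so it needs q' ≤ s', the dual form of s ≤ q.
  have hqs' : q' ≤ s' := by
    rw [hq', hs', div_le_div_iff₀ (by linarith) (by linarith)]
    nlinarith
  have hq'inv : 1 / q' = 1 - 1 / q := by
    rw [hq']; field_simp
  set δ := (1 / p - 1 / q) / 2 with hδ
  have hδ0 : 0 < δ := by
    have : 1 / q < 1 / p := one_div_lt_one_div_of_lt hp0 hpq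
    rw [hδ]; linarith
  have hgT : ∀ x, g x ≠ ∞ := fun x => ne_top_of_le_ne_top ENNReal.coe_ne_top (hgN x)
  have hhT : ∀ x, h x ≠ ∞ := fun x => ne_top_of_le_ne_top ENNReal.coe_ne_top (hhN x)
  have hGT : ∀ i, orliczNorm A (Q i) g ≠ ∞ := fun i =>
    (orliczNorm_lt_top_of_le hA (hQ.volume_ne_zero i) (hQ.volume_ne_top i) N hgN).ne
  have hHT : ∀ i, orliczNorm B (Q i) h ≠ ∞ := fun i =>
    (orliczNorm_lt_top_of_le hB (hQ.volume_ne_zero i) (hQ.volume_ne_top i) N hhN).ne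
  -- The dyadic levels of the score need positive norms; the discarded terms vanish.
  set T' := T.filter fun i => orliczNorm A (Q i) g ≠ 0 ∧ orliczNorm B (Q i) h ≠ 0 with hT'
  have hsmall : ∀ (A : ℝ → ℝ) (_ : OrliczFun A) (g : Rd d → ℝ≥0∞) (_ : ∀ x, g x ≠ ∞)
      (_ : ∀ i, orliczNorm A (Q i) g ≠ ∞) (_ : ∀ i ∈ T', orliczNorm A (Q i) g ≠ 0)
      (R : ι) (n : ℕ) (M : Finset ι), R ∈ T' → M ⊆ T' → (M : Set ι).PairwiseDisjoint Q →
      (∀ i ∈ M, Q i ⊆ Q R) →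
      (∀ i ∈ M, 2 ^ (n + 1) * (orliczNorm A (Q R) g).toReal < (orliczNorm A (Q i) g).toReal) →
      ∑ i ∈ M, (volume (Q i)).toReal ≤ (volume (Q R)).toReal / 2 ^ n := by
    intro A hA g hgT hGT hG0 R n M hR hM hMd hMR hlt
    have := sum_volume_le_of_orliczNorm_lt hQ hA hgT hMd R hMR (hG0 R hR) n fun i hi => by
      rw [← ENNReal.toReal_lt_toReal (ENNReal.mul_ne_top (by finiteness) (hGT R)) (hGT i)]
      simpa using hlt i hi
    have h2 := ENNReal.toReal_mono (ENNReal.div_ne_top (hQ.volume_ne_top R) (by positivity)) this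
    rw [ENNReal.toReal_sum fun i _ => hQ.volume_ne_top i] at h2
    simpa using h2
  have hG0 : ∀ i ∈ T', orliczNorm A (Q i) g ≠ 0 := fun i hi => (Finset.mem_filter.1 hi).2.1
  have hH0 : ∀ i ∈ T', orliczNorm B (Q i) h ≠ 0 := fun i hi => (Finset.mem_filter.1 hi).2.2
  obtain ⟨D, hDT, hD1, hD2⟩ := exists_sparse_subfamily hQ T' (fun i => (orliczNorm A (Q i) g).toReal)
    (fun i => (orliczNorm B (Q i) h).toReal) hδ0
    (fun i hi => ENNReal.toReal_pos (hG0 i hi) (hGT i))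
    (fun i hi => ENNReal.toReal_pos (hH0 i hi) (hHT i))
    (hsmall A hA g hgT hGT hG0) (hsmall B hB h hhT hHT hH0) (fun R _ M _ hM => hC R M hM)
  have hexp : 1 + 2 * δ = 1 + (1 / p - 1 / q) := by rw [hδ]; ring
  have hexp0 : 0 ≤ 1 + 2 * δ := by positivity
  rw [← hexp]
  have hterm : ∀ i, volume (Q i) ^ (1 + 2 * δ) * (orliczNorm A (Q i) g * orliczNorm B (Q i) h) =
      ENNReal.ofReal ((volume (Q i)).toReal ^ (1 + 2 * δ) * ((orliczNorm A (Q i) g).toReal *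
        (orliczNorm B (Q i) h).toReal)) := by
    intro i
    rw [ENNReal.ofReal_mul (by positivity), ENNReal.ofReal_mul (by positivity),
      ENNReal.ofReal_toReal (hGT i), ENNReal.ofReal_toReal (hHT i),
      ← ENNReal.ofReal_rpow_of_nonneg (by positivity) hexp0,
      ENNReal.ofReal_toReal (hQ.volume_ne_top i)]
  have hD1' : ∑ i ∈ T', volume (Q i) ^ (1 + 2 * δ) *
        (orliczNorm A (Q i) g * orliczNorm B (Q i) h) ≤
      ENNReal.ofReal (4 * C) * ∑ i ∈ D, volume (Q i) ^ (1 + 2 * δ) *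
        (orliczNorm A (Q i) g * orliczNorm B (Q i) h) := by
    simp only [hterm]
    rw [← ENNReal.ofReal_sum_of_nonneg fun i _ => by positivity,
      ← ENNReal.ofReal_sum_of_nonneg fun i _ => by positivity,
      ← ENNReal.ofReal_mul (by positivity)]
    exact ENNReal.ofReal_le_ofReal hD1
  have hD2' : ∀ R ∈ D, ∀ M ⊆ D, (∀ i ∈ M, Q i ⊆ Q R) →
      ∑ i ∈ M, volume (Q i) ≤ 16 * volume (Q R) := by
    intro R hR M hM hMR
    rw [← ENNReal.toReal_le_toReal (ENNReal.sum_ne_top.2 fun i _ => hQ.volume_ne_top i)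
      (ENNReal.mul_ne_top (by finiteness) (hQ.volume_ne_top R)),
      ENNReal.toReal_sum fun i _ => hQ.volume_ne_top i]
    simpa using hD2 R hR M hM hMR
  have hT'sum : ∑ i ∈ T, volume (Q i) ^ (1 + 2 * δ) *
        (orliczNorm A (Q i) g * orliczNorm B (Q i) h) =
      ∑ i ∈ T', volume (Q i) ^ (1 + 2 * δ) *
        (orliczNorm A (Q i) g * orliczNorm B (Q i) h) := by
    refine (Finset.sum_filter_of_ne fun i _ hne => ?_).symm
    constructor
    · intro h0; simp [h0] at hne
    · intro h0; simp [h0] at hne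
  have eA := carleson_embedding hQ hA hp0 hps hg hgT D hD2' (fun R hR => hG0 R (hDT hR))
    (fun R _ => hGT R)
  have eB := carleson_embedding hQ hB hq'0 hqs' hh hhT D hD2' (fun R hR => hH0 R (hDT hR))
    (fun R _ => hHT R)
  set KA := ENNReal.ofReal (2 ^ s) * 32 ^ (s / p) *
    (ENNReal.ofReal (2 ^ s) * ∑' k : ℤ, bCoeff A p s k) with hKA
  set KB := ENNReal.ofReal (2 ^ s') * 32 ^ (s' / q') *
    (ENNReal.ofReal (2 ^ s') * ∑' k : ℤ, bCoeff B q' s' k) with hKB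
  clear_value KA KB
  rw [hT'sum]
  refine hD1'.trans ?_
  rw [mul_assoc]
  gcongr
  calc ∑ i ∈ D, volume (Q i) ^ (1 + 2 * δ) * (orliczNorm A (Q i) g * orliczNorm B (Q i) h)
      = ∑ i ∈ D, (volume (Q i) ^ (1 / p) * orliczNorm A (Q i) g) *
          (volume (Q i) ^ (1 / q') * orliczNorm B (Q i) h) := by
        refine Finset.sum_congr rfl fun i _ => ?_
        -- The exponent of the volume splits into exactly the powers that the two embeddings
        -- require.
        have : 1 + 2 * δ = 1 / p + 1 / q' := by rw [hexp, hq'inv]; ring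
        rw [this, ENNReal.rpow_add _ _ (hQ.volume_ne_zero i) (hQ.volume_ne_top i)]
        ring
    _ ≤ (∑ i ∈ D, (volume (Q i) ^ (1 / p) * orliczNorm A (Q i) g) ^ s) ^ (1 / s) *
        (∑ i ∈ D, (volume (Q i) ^ (1 / q') * orliczNorm B (Q i) h) ^ s') ^ (1 / s') :=
        ENNReal.inner_le_Lp_mul_Lq D _ _ hconj
    _ = (∑ i ∈ D, volume (Q i) ^ (s / p) * orliczNorm A (Q i) g ^ s) ^ (1 / s) *
        (∑ i ∈ D, volume (Q i) ^ (s' / q') * orliczNorm B (Q i) h ^ s') ^ (1 / s') := by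
        have : ∀ (a b : ℝ) (_ : 0 < b) (u v : ℝ≥0∞),
            (u ^ (1 / a) * v) ^ b = u ^ (b / a) * v ^ b := by
          intro a b hb u v
          rw [ENNReal.mul_rpow_of_nonneg _ _ hb.le, ← ENNReal.rpow_mul]
          congr 2; ring
        simp only [this p s hs0, this q' s' hs'0]
    _ ≤ (KA * (∫⁻ x, g x ^ p) ^ (s / p)) ^ (1 / s) *
        (KB * (∫⁻ x, h x ^ q') ^ (s' / q')) ^ (1 / s') := by gcongr
    _ = _ := by
        rw [ENNReal.mul_rpow_of_nonneg _ _ (by positivity),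
          ENNReal.mul_rpow_of_nonneg _ _ (by positivity), ← ENNReal.rpow_mul, ← ENNReal.rpow_mul,
          show s / p * (1 / s) = 1 / p by field_simp, show s' / q' * (1 / s') = 1 / q' by field_simp]
        ring
end nested

/-! ### Adjacent dyadic grids -/

/-- The shift of the `k`-th generation of a one-dimensional dyadic grid. -/
noncomputable def gridShift (b : Bool) (k : ℤ) : ℝ :=
  if b then (if Even k then 1 / 3 else -(1 / 3)) else 0

/-- The index of the interval of generation `k` containing `x`. -/
noncomputable def gridIdx (b : Bool) (k : ℤ) (x : ℝ) : ℤ := ⌊x / 2 ^ k - gridShift b k⌋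

/-- The half-open cubes of the dyadic grid with shift parameters `t`. -/
def gridCube {d : ℕ} (t : Fin d → Bool) (j : ℤ × (Fin d → ℤ)) : Set (Rd d) :=
  {x | ∀ i, gridIdx (t i) j.1 (x i) = j.2 i}

noncomputable def gridCenter {d : ℕ} (t : Fin d → Bool) (j : ℤ × (Fin d → ℤ)) : Rd d :=
  WithLp.toLp 2 fun i => (j.2 i + gridShift (t i) j.1 + 1 / 2) * 2 ^ j.1

/-- The sign alternates because ±1/3 - 2(∓1/3) = ±1 is an integer: endpoints of generation k + 1 are
then endpoints of generation k. -/
lemma gridShift_succ (b : Bool) (k : ℤ) :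
    ∃ e : ℤ, gridShift b k - 2 * gridShift b (k + 1) = e := by
  unfold gridShift
  cases b
  · exact ⟨0, by simp⟩
  · by_cases hk : Even k
    · have : ¬ Even (k + 1) := by rw [Int.even_add_one]; simpa using hk
      exact ⟨1, by simp [hk, this]; norm_num⟩
    · have : Even (k + 1) := by rw [Int.even_add_one]; exact hk
      exact ⟨-1, by simp [hk, this]; norm_num⟩

lemma gridIdx_succ {b : Bool} {k : ℤ} {x y : ℝ} (h : gridIdx b k x = gridIdx b k y) :
    gridIdx b (k + 1) x = gridIdx b (k + 1) y := by
  obtain ⟨e, he⟩ := gridShift_succ b k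
  -- The coarser index is a function of the finer one, which is all that nestedness needs.
  have key : ∀ z : ℝ, gridIdx b (k + 1) z = (gridIdx b k z + e) / 2 := by
    intro z
    have h1 : z / 2 ^ (k + 1) - gridShift b (k + 1) =
        ((z / 2 ^ k - gridShift b k) + e) / (2 : ℕ) := by
      rw [← he, zpow_add_one₀ two_ne_zero]
      field_simp
      push_cast
      ring
    unfold gridIdx
    rw [h1, Int.floor_div_natCast, Int.floor_add_intCast]
    simp
  rw [key, key, h]

lemma gridIdx_of_le {b : Bool} {k l : ℤ} (hkl : k ≤ l) {x y : ℝ}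
    (h : gridIdx b k x = gridIdx b k y) : gridIdx b l x = gridIdx b l y := by
  induction l, hkl using Int.leInduction with
  | base => exact h
  | succ l _ ih => exact gridIdx_succ ih

/-- Endpoints of the shifted and unshifted grids are at least 2^k/3 apart. If both grids separated
the points, two such endpoints n and m + c (in units of 2^k) would differ by strictly less than 1/3,
impossible for c = ±1/3. -/
lemma exists_gridIdx_eq {k : ℤ} {x y : ℝ} (h : |x - y| ≤ 2 ^ k / 3) :
    ∃ b, gridIdx b k x = gridIdx b k y := by
  have hk : (0 : ℝ) < 2 ^ k := by positivity
  have key : ∀ u v : ℝ, u ≤ v → v - u ≤ 1 / 3 → ∀ c : ℝ, (c = 1 / 3 ∨ c = -(1 / 3)) →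
      ⌊u⌋ = ⌊v⌋ ∨ ⌊u - c⌋ = ⌊v - c⌋ := by
    intro u v huv huv2 c hc
    by_contra! hcon
    obtain ⟨h1, h2⟩ := hcon
    have h1' : ⌊u⌋ < ⌊v⌋ := lt_of_le_of_ne (Int.floor_le_floor huv) h1
    have h2' : ⌊u - c⌋ < ⌊v - c⌋ := lt_of_le_of_ne (Int.floor_le_floor (by linarith)) h2
    have a1 := Int.floor_lt.1 h1'
    have a2 := Int.floor_lt.1 h2'
    have a3 := Int.floor_le v
    have a4 := Int.floor_le (v - c)
    set n := ⌊v⌋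
    set m := ⌊v - c⌋
    have b1 : (n : ℝ) - m - c < 1 / 3 := by linarith
    have b2 : -(1 / 3) < (n : ℝ) - m - c := by linarith
    rcases hc with rfl | rfl
    · have c1 : ((n - m : ℤ) : ℝ) < 1 := by push_cast; linarith
      have c2 : (0 : ℝ) < ((n - m : ℤ) : ℝ) := by push_cast; linarith
      norm_cast at c1 c2
      omega
    · have c1 : ((n - m : ℤ) : ℝ) < 0 := by push_cast; linarith
      have c2 : (-1 : ℝ) < ((n - m : ℤ) : ℝ) := by push_cast; linarith
      norm_cast at c1 c2
      omega
  have hc : gridShift true k = 1 / 3 ∨ gridShift true k = -(1 / 3) := by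
    unfold gridShift
    by_cases hk : Even k <;> simp [hk]
  have h0 : gridShift false k = 0 := by simp [gridShift]
  have habs : |x / 2 ^ k - y / 2 ^ k| ≤ 1 / 3 := by
    rw [← sub_div, abs_div, abs_of_pos hk, div_le_iff₀ hk]
    linarith
  rw [abs_le] at habs
  have hor : ⌊x / 2 ^ k⌋ = ⌊y / 2 ^ k⌋ ∨
      ⌊x / 2 ^ k - gridShift true k⌋ = ⌊y / 2 ^ k - gridShift true k⌋ := by
    rcases le_total (x / 2 ^ k) (y / 2 ^ k) with hxy | hxy
    · exact key _ _ hxy (by linarith) _ hc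
    · exact (key _ _ hxy (by linarith) _ hc).imp Eq.symm Eq.symm
  rcases hor with h | h
  · exact ⟨false, by simpa [gridIdx, h0] using h⟩
  · exact ⟨true, h⟩

lemma gridIdx_eq_iff (b : Bool) (k : ℤ) (x : ℝ) (m : ℤ) :
    gridIdx b k x = m ↔
      x ∈ Set.Ico ((m + gridShift b k) * 2 ^ k) ((m + gridShift b k + 1) * 2 ^ k) := by
  have hk : (0 : ℝ) < 2 ^ k := by positivity
  unfold gridIdx
  rw [Int.floor_eq_iff, Set.mem_Ico, ← le_div_iff₀ hk, ← div_lt_iff₀ hk]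
  constructor <;> rintro ⟨h1, h2⟩ <;> constructor <;> linarith

section
variable {d : ℕ} (t : Fin d → Bool)

lemma gridCube_eq_preimage (j : ℤ × (Fin d → ℤ)) :
    gridCube t j = (WithLp.ofLp : Rd d → (Fin d → ℝ)) ⁻¹' (Set.univ.pi fun i =>
      Set.Ico ((j.2 i + gridShift (t i) j.1) * 2 ^ j.1)
        ((j.2 i + gridShift (t i) j.1 + 1) * 2 ^ j.1)) := by
  ext x
  simp only [gridCube, Set.mem_ofPred_eq, Set.mem_preimage, Set.mem_univ_pi, gridIdx_eq_iff]

lemma measurableSet_gridCube (j : ℤ × (Fin d → ℤ)) : MeasurableSet (gridCube t j) := by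
  rw [gridCube_eq_preimage]
  exact (PiLp.volume_preserving_ofLp (Fin d)).measurable
    (MeasurableSet.univ_pi fun i => measurableSet_Ico)

lemma volume_gridCube (j : ℤ × (Fin d → ℤ)) :
    volume (gridCube t j) = ENNReal.ofReal ((2 : ℝ) ^ j.1) ^ d := by
  rw [gridCube_eq_preimage, (PiLp.volume_preserving_ofLp (Fin d)).measure_preimage
    (MeasurableSet.univ_pi fun i => measurableSet_Ico).nullMeasurableSet, Real.volume_pi_Ico]
  rw [Finset.prod_congr rfl fun i _ => (by
    rw [← sub_mul]; ring_nf :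
    ENNReal.ofReal ((j.2 i + gridShift (t i) j.1 + 1) * 2 ^ j.1 -
      (j.2 i + gridShift (t i) j.1) * 2 ^ j.1) = ENNReal.ofReal ((2 : ℝ) ^ j.1))]
  simp

/-- Passes from the half-open dyadic cubes to the closed cubes of the bump constant. -/
lemma gridCube_ae_eq_cube (j : ℤ × (Fin d → ℤ)) :
    gridCube t j =ᵐ[volume] cube (gridCenter t j) (2 ^ j.1 / 2) := by
  have h : cube (gridCenter t j) (2 ^ j.1 / 2) =
      (WithLp.ofLp : Rd d → (Fin d → ℝ)) ⁻¹' (Set.Icc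
        (fun i => (j.2 i + gridShift (t i) j.1) * 2 ^ j.1)
        (fun i => (j.2 i + gridShift (t i) j.1 + 1) * 2 ^ j.1)) := by
    ext x
    simp only [cube, gridCenter, Set.mem_ofPred_eq, Set.mem_preimage, Set.mem_Icc, Pi.le_def,
      ← forall_and, abs_le]
    refine forall_congr' fun i => ?_
    constructor <;> rintro ⟨h1, h2⟩ <;> constructor <;> linarith
  rw [h, gridCube_eq_preimage]
  exact (PiLp.volume_preserving_ofLp (Fin d)).quasiMeasurePreserving.preimage_ae_eq
    Measure.univ_pi_Ico_ae_eq_Icc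

/-- Injectivity is where d ≠ 0 matters: the volume then determines the generation. -/
lemma nestedFamily_gridCube (hd : d ≠ 0) : NestedFamily (gridCube t) := by
  have hne : ∀ j, volume (gridCube t j) ≠ 0 := by
    intro j
    rw [volume_gridCube]
    exact pow_ne_zero _ (by simp; positivity)
  have hsub : ∀ i j : ℤ × (Fin d → ℤ), i.1 ≤ j.1 → ∀ x ∈ gridCube t i, x ∈ gridCube t j →
      gridCube t i ⊆ gridCube t j := by
    intro i j hij x hxi hxj y hy l
    rw [← hxj l]
    exact gridIdx_of_le hij ((hy l).trans (hxi l).symm)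
  refine ⟨?_, measurableSet_gridCube t, hne, ?_, ?_⟩
  · intro i j hij
    have hij' : gridCube t i = gridCube t j := hij
    obtain ⟨x, hx⟩ := nonempty_of_measure_ne_zero (hne i)
    have hx' : x ∈ gridCube t j := hij' ▸ hx
    have hk : i.1 = j.1 := by
      have h1 : volume (gridCube t i) = volume (gridCube t j) := by rw [hij']
      rw [volume_gridCube, volume_gridCube] at h1
      have h2 := (ENNReal.pow_right_strictMono hd).injective h1
      rw [ENNReal.ofReal_eq_ofReal_iff (by positivity) (by positivity)] at h2
      exact zpow_right_injective₀ two_pos (by norm_num) h2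
    refine Prod.ext hk (funext fun l => ?_)
    rw [← hx l, ← hx' l, hk]
  · intro j
    rw [volume_gridCube]
    finiteness
  · intro i j
    by_cases hd' : Disjoint (gridCube t i) (gridCube t j)
    · exact Or.inr (Or.inr hd')
    · obtain ⟨x, hxi, hxj⟩ := Set.not_disjoint_iff.1 hd'
      rcases le_total i.1 j.1 with h | h
      · exact Or.inl (hsub i j h x hxi hxj)
      · exact Or.inr (Or.inl (hsub j i h x hxj hxi))

/-- The cubes n generations below R are disjoint, and each satisfies |Q|^δ = |R|^δ 2^{-ndδ}; the sum
over n is a geometric series. -/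
lemma sum_volume_gridCube_rpow_le (hd : d ≠ 0) {δ : ℝ} (hδ : 0 < δ) (R : ℤ × (Fin d → ℤ))
    (M : Finset (ℤ × (Fin d → ℤ))) (hM : ∀ i ∈ M, gridCube t i ⊆ gridCube t R) :
    ∑ i ∈ M, (volume (gridCube t i)).toReal ^ (1 + δ) ≤
      (1 - (2 : ℝ) ^ (-(d * δ)))⁻¹ * (volume (gridCube t R)).toReal ^ (1 + δ) := by
  classical
  have hQ := nestedFamily_gridCube t hd
  have hd0 : (0 : ℝ) < d := by exact_mod_cast Nat.pos_of_ne_zero hd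
  have hv : ∀ i, (volume (gridCube t i)).toReal = (2 : ℝ) ^ (i.1 * d : ℝ) := by
    intro i
    rw [volume_gridCube, ENNReal.toReal_pow, ENNReal.toReal_ofReal (by positivity),
      Real.rpow_mul zero_le_two, Real.rpow_intCast, Real.rpow_natCast]
  set v := fun i => (volume (gridCube t i)).toReal with hvdef
  have hv' : ∀ i, v i = (2 : ℝ) ^ (i.1 * d : ℝ) := hv
  have hv0 : ∀ i, 0 < v i := fun i => by rw [hv']; positivity
  set x : ℝ := (2 : ℝ) ^ (-(d * δ)) with hx
  have hx0 : 0 < x := by positivity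
  have hx1 : x < 1 := Real.rpow_lt_one_of_one_lt_of_neg one_lt_two (by nlinarith)
  have hk : ∀ i ∈ M, i.1 ≤ R.1 := by
    intro i hi
    have h1 : v i ≤ v R := ENNReal.toReal_mono (hQ.volume_ne_top R) (measure_mono (hM i hi))
    rw [hv', hv', Real.rpow_le_rpow_left_iff one_lt_two] at h1
    exact_mod_cast le_of_mul_le_mul_right h1 hd0
  set N : ℤ × (Fin d → ℤ) → ℕ := fun i => (R.1 - i.1).toNat with hN
  have hNi : ∀ i ∈ M, i.1 = R.1 - N i := fun i hi => by
    have := hk i hi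
    simp only [hN]; omega
  have hlevel : ∀ n : ℕ, ∑ i ∈ M with N i = n, v i ^ (1 + δ) ≤ v R ^ (1 + δ) * x ^ n := by
    intro n
    have hpd : ((M.filter fun i => N i = n : Finset _) : Set _).PairwiseDisjoint (gridCube t) := by
      intro i hi j hj hij
      obtain ⟨hi, hin⟩ := Finset.mem_filter.1 (Finset.mem_coe.1 hi)
      obtain ⟨hj, hjn⟩ := Finset.mem_filter.1 (Finset.mem_coe.1 hj)
      have h1 : i.1 = j.1 := by rw [hNi i hi, hNi j hj, hin, hjn]
      refine Set.disjoint_left.2 fun y hyi hyj => hij (Prod.ext h1 (funext fun l => ?_))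
      rw [← hyi l, ← hyj l, h1]
    have h1 := ENNReal.toReal_mono (hQ.volume_ne_top R) (sum_volume_le hQ hpd (gridCube t R)
      fun i hi => hM i (Finset.mem_filter.1 hi).1)
    rw [ENNReal.toReal_sum fun i _ => hQ.volume_ne_top i] at h1
    calc ∑ i ∈ M with N i = n, v i ^ (1 + δ)
        = ∑ i ∈ M with N i = n, v i * (v R ^ δ * x ^ n) := by
          refine Finset.sum_congr rfl fun i hi => ?_
          obtain ⟨hi, hin⟩ := Finset.mem_filter.1 hi
          rw [Real.rpow_add (hv0 i), Real.rpow_one]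
          congr 1
          rw [hv', hv', hx, ← Real.rpow_natCast, ← Real.rpow_mul zero_le_two,
            ← Real.rpow_mul zero_le_two, ← Real.rpow_mul zero_le_two, ← Real.rpow_add two_pos,
            hNi i hi, hin]
          congr 1
          push_cast
          ring
      _ = (∑ i ∈ M with N i = n, v i) * (v R ^ δ * x ^ n) := by rw [Finset.sum_mul]
      _ ≤ v R * (v R ^ δ * x ^ n) := by
          have := hv0 R
          gcongr
      _ = _ := by rw [Real.rpow_add (hv0 R), Real.rpow_one]; ring
  calc ∑ i ∈ M, v i ^ (1 + δ) = ∑ n ∈ M.image N, ∑ i ∈ M with N i = n, v i ^ (1 + δ) :=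
        (Finset.sum_fiberwise_of_maps_to (fun i hi => Finset.mem_image_of_mem N hi) _).symm
    _ ≤ ∑ n ∈ M.image N, v R ^ (1 + δ) * x ^ n := Finset.sum_le_sum fun n _ => hlevel n
    _ = v R ^ (1 + δ) * ∑ n ∈ M.image N, x ^ n := by rw [Finset.mul_sum]
    _ ≤ v R ^ (1 + δ) * (1 - x)⁻¹ := by
        have := hv0 R
        gcongr
        rw [← tsum_geometric_of_lt_one hx0.le hx1]
        exact (summable_geometric_of_lt_one hx0.le hx1).sum_le_tsum _ fun _ _ => by positivity
    _ = _ := mul_comm _ _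

end

/-- Two distinct points lie in a common cube, of comparable side length, of one of the grids. -/
lemma exists_gridCube {d : ℕ} {x y : Rd d} (hxy : x ≠ y) :
    ∃ (t : Fin d → Bool) (j : ℤ × (Fin d → ℤ)), x ∈ gridCube t j ∧ y ∈ gridCube t j ∧
      (2 : ℝ) ^ j.1 ≤ 6 * ‖x - y‖ := by
  have hr : 0 < ‖x - y‖ := norm_pos_iff.2 (sub_ne_zero.2 hxy)
  -- From 2^k < 3|x-y| ≤ 2^{k+1}: generation k + 1 meets the one-third condition, and its side is
  -- below 6|x-y|. The shift is chosen separately in each coordinate.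
  obtain ⟨k, hk1, hk2⟩ := exists_mem_Ioc_zpow (show 0 < 3 * ‖x - y‖ by positivity) one_lt_two
  have hex : ∀ i, ∃ b, gridIdx b (k + 1) (x i) = gridIdx b (k + 1) (y i) := by
    intro i
    refine exists_gridIdx_eq ?_
    have h1 : |x i - y i| ≤ ‖x - y‖ := by
      simpa using PiLp.norm_apply_le (x - y) i
    linarith
  choose t ht using hex
  refine ⟨t, (k + 1, fun i => gridIdx (t i) (k + 1) (x i)), fun i => rfl, fun i => (ht i).symm, ?_⟩
  show (2 : ℝ) ^ (k + 1) ≤ _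
  rw [zpow_add_one₀ two_ne_zero]
  linarith

lemma norm_sub_gridCenter_le {d : ℕ} {t : Fin d → Bool} {j : ℤ × (Fin d → ℤ)} {x : Rd d}
    (hx : x ∈ gridCube t j) : ‖x - gridCenter t j‖ ≤ √d * 2 ^ j.1 := by
  have hk : (0 : ℝ) < 2 ^ j.1 := by positivity
  rw [EuclideanSpace.norm_eq]
  calc √(∑ i, ‖(x - gridCenter t j) i‖ ^ 2) ≤ √(∑ i : Fin d, ((2 : ℝ) ^ j.1) ^ 2) := by
        refine Real.sqrt_le_sqrt (Finset.sum_le_sum fun i _ => ?_)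
        gcongr
        have h := (gridIdx_eq_iff _ _ _ _).1 (hx i)
        have e : (x - gridCenter t j) i = x i - (j.2 i + gridShift (t i) j.1 + 1 / 2) * 2 ^ j.1 :=
          rfl
        rw [e, Real.norm_eq_abs, abs_le]
        constructor <;> nlinarith [h.1, h.2]
    _ = √d * 2 ^ j.1 := by
        simp [Real.sqrt_mul, Real.sqrt_sq hk.le]

/-! ### The kernel of the fractional integral -/

/-- The absolute kernel `∫₀^∞ |p_t(x, y)| t ^ (α/2 - 1) dt`. -/
noncomputable def absKernel {d : ℕ} (k : ℝ → Rd d → Rd d → ℂ) (α : ℝ) (x y : Rd d) : ℝ≥0∞ :=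
  ∫⁻ t in Set.Ioi (0 : ℝ), ENNReal.ofReal (t ^ (α / 2 - 1)) * ‖k t x y‖ₑ

lemma exp_neg_le_rpow {m w : ℝ} (hm : 0 < m) (hw : 0 < w) :
    Real.exp (-w) ≤ m ^ m * w ^ (-m) := by
  have h1 : w / m ≤ Real.exp (w / m) := by linarith [Real.add_one_le_exp (w / m)]
  have h2 : (w / m) ^ m ≤ Real.exp w := by
    calc (w / m) ^ m ≤ Real.exp (w / m) ^ m := Real.rpow_le_rpow (by positivity) h1 hm.le
      _ = Real.exp w := by rw [← Real.exp_mul]; congr 1; field_simp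
  rw [Real.exp_neg, Real.rpow_neg hw.le, ← div_eq_mul_inv, inv_le_comm₀ (by positivity)
    (by positivity), inv_div, ← Real.div_rpow hw.le hm.le]
  exact h2

/-- For √t ≤ r one has 1 + √t/ρ ≥ (√t/r)(1 + r/ρ). Gaussian decay, used as the power (N+d)/2 of
t/r², pays both for the lost factor (√t/r)^{-N} and for t^{-d/2}; all powers of t cancel. -/
lemma gaussian_small_time_le {d : ℕ} {c N r ρ t : ℝ} (hc : 0 < c) (hN : 0 < N) (hr : 0 < r)
    (hρ : 0 < ρ) (ht : 0 < t) (htr : t ≤ r ^ 2) :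
    1 / t ^ ((d : ℝ) / 2) * Real.exp (-(r ^ 2 / (c * t))) * (1 + √t / ρ) ^ (-N) ≤
      (((N + d) / 2) ^ ((N + d) / 2) * c ^ ((N + d) / 2)) * r ^ (-(d : ℝ)) * (1 + r / ρ) ^ (-N) := by
  set m := (N + d) / 2 with hm
  have hm0 : 0 < m := by positivity
  have hst : 0 < √t := Real.sqrt_pos.2 ht
  have hstr : √t ≤ r := by rw [Real.sqrt_le_left hr.le]; exact htr
  have h1 := exp_neg_le_rpow hm0 (show 0 < r ^ 2 / (c * t) by positivity)
  have h2 : (1 + √t / ρ) ^ (-N) ≤ (√t / r) ^ (-N) * (1 + r / ρ) ^ (-N) := by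
    rw [← Real.mul_rpow (by positivity) (by positivity)]
    refine Real.rpow_le_rpow_of_nonpos (by positivity) ?_ (by linarith)
    have e : √t / r * (1 + r / ρ) = √t / r + √t / ρ := by field_simp
    rw [e]
    have : √t / r ≤ 1 := (div_le_one hr).2 hstr
    linarith
  have hsq : √t = t ^ (1 / 2 : ℝ) := Real.sqrt_eq_rpow t
  have e1 : (r ^ 2 / (c * t)) ^ (-m) = c ^ m * t ^ m * (r ^ (2 * m))⁻¹ := by
    rw [Real.rpow_neg (by positivity), Real.div_rpow (by positivity) (by positivity),
      Real.mul_rpow hc.le ht.le, inv_div, ← Real.rpow_natCast r 2, ← Real.rpow_mul hr.le]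
    rw [div_eq_mul_inv]; norm_num
  have e2 : (√t / r) ^ (-N) = (t ^ (N / 2))⁻¹ * r ^ N := by
    rw [Real.rpow_neg (by positivity), Real.div_rpow hst.le hr.le, inv_div, hsq,
      ← Real.rpow_mul ht.le, div_eq_mul_inv, mul_comm]
    congr 3; ring
  have e3 : t ^ m = t ^ ((d : ℝ) / 2) * t ^ (N / 2) := by
    rw [← Real.rpow_add ht]; congr 1; rw [hm]; ring
  have e4 : r ^ (2 * m) = r ^ N * r ^ (d : ℝ) := by
    rw [← Real.rpow_add hr]; congr 1; rw [hm]; ring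
  calc _ ≤ 1 / t ^ ((d : ℝ) / 2) * (m ^ m * (r ^ 2 / (c * t)) ^ (-m)) *
        ((√t / r) ^ (-N) * (1 + r / ρ) ^ (-N)) := by gcongr
    _ = _ := by
        rw [e1, e2, e3, e4, Real.rpow_neg hr.le]
        have a1 : 0 < t ^ ((d : ℝ) / 2) := by positivity
        have a2 : 0 < t ^ (N / 2) := by positivity
        have a3 : 0 < r ^ N := by positivity
        have a4 : 0 < r ^ (d : ℝ) := by positivity
        field_simp

lemma lintegral_Ioc_rpow {a R : ℝ} (ha : 0 < a) (hR : 0 < R) :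
    ∫⁻ t in Set.Ioc 0 R, ENNReal.ofReal (t ^ (a - 1)) = ENNReal.ofReal (R ^ a / a) := by
  have hi : IntervalIntegrable (fun t : ℝ => t ^ (a - 1)) volume 0 R :=
    intervalIntegral.intervalIntegrable_rpow' (by linarith)
  rw [← ofReal_integral_eq_lintegral_ofReal ((intervalIntegrable_iff_integrableOn_Ioc_of_le hR.le).1 hi)]
  · rw [← intervalIntegral.integral_of_le hR.le, integral_rpow (Or.inl (by linarith))]
    simp [Real.zero_rpow ha.ne']
  · filter_upwards [ae_restrict_mem measurableSet_Ioc] with t ht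
    exact Real.rpow_nonneg ht.1.le _

lemma lintegral_Ioi_rpow {a R : ℝ} (ha : 0 < a) (hR : 0 < R) :
    ∫⁻ t in Set.Ioi R, ENNReal.ofReal (t ^ (-a - 1)) = ENNReal.ofReal (R ^ (-a) / a) := by
  rw [← ofReal_integral_eq_lintegral_ofReal (integrableOn_Ioi_rpow_of_lt (by linarith) hR)]
  · rw [integral_Ioi_rpow_of_lt (by linarith) hR]
    congr 1
    rw [show -a - 1 + 1 = -a by ring, neg_div_neg_eq]
  · filter_upwards [ae_restrict_mem measurableSet_Ioi] with t ht
    exact Real.rpow_nonneg (hR.trans ht).le _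

/-- Split at t = |x-y|². Below, the small-time bound leaves t^{α/2-1}, integrable at 0 since α > 0.
Above, the Gaussian is at most 1, √t ≥ |x-y| keeps the decay in ρ(x), and t^{(α-d)/2-1} is
integrable at infinity since α < d. -/
lemma absKernel_le {d : ℕ} {ρ : Rd d → ℝ} {k : ℝ → Rd d → Rd d → ℂ} (hρ : ∀ x, 0 < ρ x)
    (hb : HeatKernelBound ρ k) {α : ℝ} (hα : 0 < α) (hαd : α < d) {N : ℝ} (hN : 0 < N) :
    ∃ C : ℝ, 0 < C ∧ ∀ x y : Rd d, x ≠ y → absKernel k α x y ≤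
      ENNReal.ofReal (C * ‖x - y‖ ^ (α - d) * (1 + ‖x - y‖ / ρ x) ^ (-N)) := by
  obtain ⟨c, hc, C₁, hC₁, hk⟩ := hb N hN
  have hd0 : (0 : ℝ) < d := hα.trans hαd
  have hdα : (0 : ℝ) < (d - α) / 2 := by linarith
  set m := (N + d) / 2 with hm
  have hm0 : 0 < m := by positivity
  refine ⟨C₁ * (m ^ m * c ^ m) * (2 / α) + C₁ * (2 / (d - α)), ?_, fun x y hxy => ?_⟩
  · have : 0 < (d : ℝ) - α := by linarith
    positivity
  have hr : 0 < ‖x - y‖ := norm_pos_iff.2 (sub_ne_zero.2 hxy)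
  set r := ‖x - y‖ with hrdef
  have hx := hρ x
  have hy := hρ y
  set a := (1 + r / ρ x) ^ (-N) with ha
  have ha0 : 0 < a := by positivity
  have hdrop : ∀ t : ℝ, 0 < t → ‖k t x y‖ ≤ C₁ * (1 / t ^ ((d : ℝ) / 2) *
      Real.exp (-(r ^ 2 / (c * t))) * (1 + √t / ρ x) ^ (-N)) := by
    intro t ht
    refine (hk x y t ht).trans ?_
    have h1 : (1 + √t / ρ x + √t / ρ y) ^ (-N) ≤ (1 + √t / ρ x) ^ (-N) := by
      refine Real.rpow_le_rpow_of_nonpos (by positivity) ?_ (by linarith)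
      have : 0 ≤ √t / ρ y := by positivity
      linarith
    calc _ ≤ C₁ / t ^ ((d : ℝ) / 2) * Real.exp (-(r ^ 2 / (c * t))) * (1 + √t / ρ x) ^ (-N) := by
          gcongr
      _ = _ := by ring
  have hsmall : ∀ t ∈ Set.Ioc 0 (r ^ 2), ENNReal.ofReal (t ^ (α / 2 - 1)) * ‖k t x y‖ₑ ≤
      ENNReal.ofReal (C₁ * ((m ^ m * c ^ m) * r ^ (-(d : ℝ)) * a)) *
        ENNReal.ofReal (t ^ (α / 2 - 1)) := by
    intro t ht
    rw [mul_comm, ← ofReal_norm]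
    gcongr
    refine (hdrop t ht.1).trans ?_
    exact mul_le_mul_of_nonneg_left (gaussian_small_time_le hc hN hr hx ht.1 ht.2) hC₁.le
  have hlarge : ∀ t ∈ Set.Ioi (r ^ 2), ENNReal.ofReal (t ^ (α / 2 - 1)) * ‖k t x y‖ₑ ≤
      ENNReal.ofReal (C₁ * a) * ENNReal.ofReal (t ^ (-((d - α) / 2) - 1)) := by
    intro t ht
    have ht' : r ^ 2 < t := ht
    have ht0 : 0 < t := lt_trans (by positivity) ht'
    rw [← ofReal_norm, ← ENNReal.ofReal_mul (by positivity), ← ENNReal.ofReal_mul (by positivity)]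
    refine ENNReal.ofReal_le_ofReal ?_
    have hrt : r ≤ √t := Real.le_sqrt_of_sq_le ht'.le
    have h1 : (1 + √t / ρ x) ^ (-N) ≤ a := by
      refine Real.rpow_le_rpow_of_nonpos (by positivity) ?_ (by linarith)
      gcongr
    have h2 : Real.exp (-(r ^ 2 / (c * t))) ≤ 1 := by
      rw [Real.exp_le_one_iff, neg_nonpos]; positivity
    calc t ^ (α / 2 - 1) * ‖k t x y‖
        ≤ t ^ (α / 2 - 1) * (C₁ * (1 / t ^ ((d : ℝ) / 2) * 1 * a)) := by
          gcongr
          refine (hdrop t ht0).trans ?_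
          gcongr
      _ = C₁ * a * (t ^ (α / 2 - 1) * t ^ (-((d : ℝ) / 2))) := by
          rw [Real.rpow_neg ht0.le]; ring
      _ = _ := by rw [← Real.rpow_add ht0]; congr 2; ring
  have hr2 : (0 : ℝ) < r ^ 2 := by positivity
  unfold absKernel
  rw [← Set.Ioc_union_Ioi_eq_Ioi hr2.le, lintegral_union measurableSet_Ioi
    (Set.disjoint_left.2 fun t h1 h2 => absurd h1.2 (not_le.2 h2))]
  refine (add_le_add (setLIntegral_mono' measurableSet_Ioc hsmall)
    (setLIntegral_mono' measurableSet_Ioi hlarge)).trans ?_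
  rw [lintegral_const_mul' _ _ ENNReal.ofReal_ne_top, lintegral_const_mul' _ _ ENNReal.ofReal_ne_top,
    lintegral_Ioc_rpow (by positivity) hr2, lintegral_Ioi_rpow hdα hr2,
    ← ENNReal.ofReal_mul (by positivity), ← ENNReal.ofReal_mul (by positivity),
    ← ENNReal.ofReal_add (by positivity) (by positivity)]
  refine ENNReal.ofReal_le_ofReal (le_of_eq ?_)
  have e1 : (r ^ 2) ^ (α / 2) = r ^ α := by
    rw [← Real.rpow_natCast, ← Real.rpow_mul hr.le]; congr 1; push_cast; ring
  have e2 : (r ^ 2) ^ (-((d - α) / 2)) = r ^ (α - d) := by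
    rw [← Real.rpow_natCast, ← Real.rpow_mul hr.le]; congr 1; push_cast; ring
  have e3 : r ^ (α - d) = r ^ α * r ^ (-(d : ℝ)) := by
    rw [← Real.rpow_add hr, sub_eq_add_neg]
  rw [e1, e2, e3]
  have : (0 : ℝ) < d - α := by linarith
  field_simp

/-- The upper critical radius bound gives ρ(x) ≲ ρ(z)(1+u)^κ, with u = l/ρ(z) and κ = N₀/(N₀+1) < 1.
Hence 1 + r/ρ(x) ≳ (1+u)^{1-κ}: some growth survives, and a large N raises it to any power. -/
lemma critical_rpow_le {d : ℕ} {ρ : Rd d → ℝ} (hρ : IsCriticalRadius ρ) {θ : ℝ} (hθ : 0 ≤ θ) :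
    ∃ N : ℝ, 0 < N ∧ ∃ C : ℝ, 0 < C ∧ ∀ (x z : Rd d) (r l : ℝ), 0 < l → l ≤ 6 * r →
      ‖x - z‖ ≤ √d * l → (1 + r / ρ x) ^ (-N) ≤ C * ((1 + l / ρ z) ^ θ)⁻¹ := by
  obtain ⟨hpos, C₀, hC₀, N₀, hN₀, h⟩ := hρ
  set κ := N₀ / (N₀ + 1) with hκ
  have hκ0 : 0 < κ := by positivity
  have hκ1 : 1 - κ = 1 / (N₀ + 1) := by rw [hκ]; field_simp; ring
  set F := max (6 * (C₀ * (1 + √d) ^ κ)) 1 with hF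
  have hF1 : 1 ≤ F := le_max_right _ _
  have hF0 : 0 < F := by linarith
  have hN : 0 < (θ + 1) * (N₀ + 1) := by positivity
  -- Since 1 - κ = 1/(N₀+1), this N yields the power θ + 1; the extra 1 keeps the choice uniform
  -- when θ = 0.
  refine ⟨(θ + 1) * (N₀ + 1), hN, F ^ ((θ + 1) * (N₀ + 1)), by positivity,
    fun x z r l hl hlr hxz => ?_⟩
  have hx := hpos x
  have hz := hpos z
  set u := l / ρ z with hu
  have hu0 : 0 < u := by positivity
  have hρx : ρ x ≤ C₀ * (1 + √d) ^ κ * ρ z * (1 + u) ^ κ := by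
    have h1 : 1 + ‖z - x‖ / ρ z ≤ (1 + √d) * (1 + u) := by
      have h2 : ‖z - x‖ / ρ z ≤ √d * u := by
        rw [norm_sub_rev, hu, ← mul_div_assoc]
        gcongr
      have h3 : 0 ≤ √(d : ℝ) := Real.sqrt_nonneg _
      nlinarith
    calc ρ x ≤ C₀ * ρ z * (1 + ‖z - x‖ / ρ z) ^ κ := (h z x).2
      _ ≤ C₀ * ρ z * ((1 + √d) * (1 + u)) ^ κ := by gcongr
      _ = _ := by rw [Real.mul_rpow (by positivity) (by positivity)]; ring
  have hw0 : 0 < (1 + u) ^ κ := by positivity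
  have hw1 : 1 ≤ (1 + u) ^ κ := Real.one_le_rpow (by linarith) hκ0.le
  have hkey : F⁻¹ * (1 + u) ^ (1 - κ) ≤ 1 + r / ρ x := by
    have h1 : u / (F * (1 + u) ^ κ) ≤ r / ρ x := by
      rw [div_le_div_iff₀ (by positivity) hx]
      have h2 : u * ρ z = l := by rw [hu]; field_simp
      have h3 : 6 * (C₀ * (1 + √d) ^ κ) ≤ F := le_max_left _ _
      have hr0 : 0 < r := by linarith
      calc u * ρ x ≤ u * (C₀ * (1 + √d) ^ κ * ρ z * (1 + u) ^ κ) := by gcongr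
        _ = l * (C₀ * (1 + √d) ^ κ) * (1 + u) ^ κ := by rw [← h2]; ring
        _ ≤ 6 * r * (C₀ * (1 + √d) ^ κ) * (1 + u) ^ κ := by gcongr
        _ = r * (6 * (C₀ * (1 + √d) ^ κ) * (1 + u) ^ κ) := by ring
        _ ≤ _ := by gcongr
    have h2 : F⁻¹ * (1 + u) ^ (1 - κ) = (1 / (F * (1 + u) ^ κ)) + u / (F * (1 + u) ^ κ) := by
      rw [Real.rpow_sub (by positivity), Real.rpow_one]
      field_simp
    have h3 : 1 / (F * (1 + u) ^ κ) ≤ 1 := by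
      rw [div_le_one (by positivity)]
      nlinarith
    rw [h2]
    linarith
  calc (1 + r / ρ x) ^ (-((θ + 1) * (N₀ + 1)))
      ≤ (F⁻¹ * (1 + u) ^ (1 - κ)) ^ (-((θ + 1) * (N₀ + 1))) :=
        Real.rpow_le_rpow_of_nonpos (by positivity) hkey (by linarith)
    _ = F ^ ((θ + 1) * (N₀ + 1)) * ((1 + u) ^ (θ + 1))⁻¹ := by
        rw [Real.mul_rpow (by positivity) (by positivity), Real.inv_rpow hF0.le,
          Real.rpow_neg hF0.le, inv_inv, ← Real.rpow_mul (by positivity), hκ1,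
          ← Real.rpow_neg (by positivity)]
        congr 2
        field_simp
    _ ≤ _ := by
        gcongr
        · linarith
        · linarith

/-- The kernel is dominated by a positive dyadic operator. -/
lemma absKernel_le_gridCube {d : ℕ} {ρ : Rd d → ℝ} {k : ℝ → Rd d → Rd d → ℂ}
    (hρ : IsCriticalRadius ρ) (hb : HeatKernelBound ρ k) {α θ : ℝ} (hα : 0 < α) (hαd : α < d)
    (hθ : 0 ≤ θ) :
    ∃ C : ℝ, 0 < C ∧ ∀ x y : Rd d, x ≠ y → ∃ (t : Fin d → Bool) (j : ℤ × (Fin d → ℤ)),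
      x ∈ gridCube t j ∧ y ∈ gridCube t j ∧
      absKernel k α x y ≤ ENNReal.ofReal C * (volume (gridCube t j) ^ (α / d - 1) /
        ENNReal.ofReal (psi ρ (θ / 3) (gridCenter t j) (2 ^ j.1 / 2))) := by
  obtain ⟨N, hN, C₂, hC₂, h2⟩ := critical_rpow_le hρ (show 0 ≤ θ / 3 by positivity)
  obtain ⟨C₁, hC₁, h1⟩ := absKernel_le hρ.1 hb hα hαd hN
  have hd0 : (0 : ℝ) < d := hα.trans hαd
  refine ⟨C₁ * 6 ^ (d - α) * C₂, by positivity, fun x y hxy => ?_⟩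
  obtain ⟨t, j, hxj, hyj, hj⟩ := exists_gridCube hxy
  refine ⟨t, j, hxj, hyj, (h1 x y hxy).trans ?_⟩
  have hr : 0 < ‖x - y‖ := norm_pos_iff.2 (sub_ne_zero.2 hxy)
  set r := ‖x - y‖
  set l : ℝ := 2 ^ j.1 with hl
  have hl0 : 0 < l := by positivity
  have hz := hρ.1 (gridCenter t j)
  have e1 : volume (gridCube t j) ^ (α / d - 1) = ENNReal.ofReal (l ^ (α - d)) := by
    rw [volume_gridCube, ← ENNReal.rpow_natCast, ← ENNReal.rpow_mul,
      ENNReal.ofReal_rpow_of_pos hl0]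
    congr 2
    field_simp
  have e2 : psi ρ (θ / 3) (gridCenter t j) (l / 2) = (1 + l / ρ (gridCenter t j)) ^ (θ / 3) := by
    unfold psi
    congr 3
    ring
  rw [e1, e2, ← ENNReal.ofReal_div_of_pos (by positivity), ← ENNReal.ofReal_mul (by positivity)]
  refine ENNReal.ofReal_le_ofReal ?_
  have h3 : r ^ (α - d) ≤ 6 ^ (d - α) * l ^ (α - d) := by
    have : l / 6 ≤ r := by linarith
    calc r ^ (α - d) ≤ (l / 6) ^ (α - d) :=
          Real.rpow_le_rpow_of_nonpos (by positivity) this (by linarith)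
      _ = _ := by
          rw [Real.div_rpow hl0.le (by norm_num), div_eq_mul_inv, ← Real.rpow_neg (by norm_num),
            neg_sub, mul_comm]
  calc C₁ * r ^ (α - d) * (1 + r / ρ x) ^ (-N)
      ≤ C₁ * (6 ^ (d - α) * l ^ (α - d)) *
        (C₂ * ((1 + l / ρ (gridCenter t j)) ^ (θ / 3))⁻¹) := by
        have := h2 x (gridCenter t j) r l hl0 hj (norm_sub_gridCenter_le hxj)
        have hx := hρ.1 x
        gcongr
    _ = _ := by ring

/-! ### The weighted bilinear estimate -/

lemma orliczNorm_congr {d : ℕ} (A : ℝ → ℝ) {Q R : Set (Rd d)} (hQR : Q =ᵐ[volume] R)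
    {g h : Rd d → ℝ≥0∞} (hgh : g =ᵐ[volume] h) : orliczNorm A Q g = orliczNorm A R h := by
  unfold orliczNorm
  have : ∀ l : ℝ≥0, ∫⁻ x in Q, youngExt A (g x / l) = ∫⁻ x in R, youngExt A (h x / l) := by
    intro l
    rw [setLIntegral_congr hQR]
    refine lintegral_congr_ae (ae_restrict_of_ae ?_)
    filter_upwards [hgh] with x hx
    rw [hx]
  simp only [this, measure_congr hQR]

/-- A bound, over all cubes, for the mixed Luxemburg norms of a two-point weight. -/
def BumpBound {d : ℕ} (ρ : Rd d → ℝ) (p q α θ : ℝ) (Φ Ψ : ℝ → ℝ) (w : Rd d → Rd d → ℝ≥0∞)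
    (B : ℝ≥0∞) : Prop :=
  ∀ (z : Rd d) (r : ℝ), 0 < r →
    volume (cube z r) ^ (α / d + 1 / q - 1 / p) / ENNReal.ofReal (psi ρ (θ / 3) z r) *
      orliczNorm Ψ (cube z r) (fun x => orliczNorm Φ (cube z r) (w x)) ≤ B

/-- The positive integral operator with kernel `K w`. -/
noncomputable def posOp {d : ℕ} (K w : Rd d → Rd d → ℝ≥0∞) (g : Rd d → ℝ≥0∞) (x : Rd d) : ℝ≥0∞ :=
  ∫⁻ y, K x y * (w x y * g y)

lemma measurable_absKernel {d : ℕ} {k : ℝ → Rd d → Rd d → ℂ}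
    (hk : Measurable fun z : ℝ × Rd d × Rd d => k z.1 z.2.1 z.2.2) (α : ℝ) :
    Measurable (Function.uncurry (absKernel k α)) := by
  have h : Measurable fun z : (Rd d × Rd d) × ℝ =>
      ENNReal.ofReal (z.2 ^ (α / 2 - 1)) * ‖k z.2 z.1.1 z.1.2‖ₑ := by
    refine Measurable.mul (by fun_prop) (Measurable.enorm ?_)
    exact hk.comp (f := fun z : (Rd d × Rd d) × ℝ => (z.2, z.1.1, z.1.2)) (by fun_prop)
  exact h.lintegral_prod_right'

lemma measurable_posOp {d : ℕ} {K w : Rd d → Rd d → ℝ≥0∞} (hK : Measurable (Function.uncurry K))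
    (hw : Measurable (Function.uncurry w)) {g : Rd d → ℝ≥0∞} (hg : Measurable g) :
    Measurable (posOp K w g) := by
  have h : Measurable fun z : Rd d × Rd d => K z.1 z.2 * (w z.1 z.2 * g z.2) :=
    hK.mul (hw.mul (hg.comp measurable_snd))
  exact h.lintegral_prod_right'

/-- Hölder with Φ in y for fixed x, then with Ψ in x; each use contributes 2|Q|. The total power α/d
+ 1 of |Q| is divided between the bump constant and the dyadic sum. -/
lemma gridCube_bilinear_le {d : ℕ} (hd : d ≠ 0) {ρ : Rd d → ℝ} {p q α θ : ℝ} {Φ Ψ : ℝ → ℝ}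
    (hΦ : IsYoung Φ) (hΨ : IsYoung Ψ) {w : Rd d → Rd d → ℝ≥0∞} {B : ℝ≥0∞}
    (hB : BumpBound ρ p q α θ Φ Ψ w B) {g h : Rd d → ℝ≥0∞} (hg : Measurable g) (hh : Measurable h)
    (N : ℝ≥0) (hgN : ∀ x, g x ≤ N) (hhN : ∀ x, h x ≤ N) (t : Fin d → Bool)
    (j : ℤ × (Fin d → ℤ)) :
    volume (gridCube t j) ^ (α / d - 1) /
        ENNReal.ofReal (psi ρ (θ / 3) (gridCenter t j) (2 ^ j.1 / 2)) *
      ∫⁻ x in gridCube t j, (∫⁻ y in gridCube t j, w x y * g y) * h x ≤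
    4 * B * (volume (gridCube t j) ^ (1 + (1 / p - 1 / q)) *
      (orliczNorm (conjYoung Φ) (gridCube t j) g * orliczNorm (conjYoung Ψ) (gridCube t j) h)) := by
  have hQ := nestedFamily_gridCube t hd
  have h0 := hQ.volume_ne_zero j
  have hT := hQ.volume_ne_top j
  have hG := (orliczNorm_lt_top_of_le hΦ.orliczFun_conj h0 hT N hgN).ne
  have hH := (orliczNorm_lt_top_of_le hΨ.orliczFun_conj h0 hT N hhN).ne
  have hae := gridCube_ae_eq_cube t j
  have hB' : volume (gridCube t j) ^ (α / d + 1 / q - 1 / p) /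
      ENNReal.ofReal (psi ρ (θ / 3) (gridCenter t j) (2 ^ j.1 / 2)) *
      orliczNorm Ψ (gridCube t j) (fun x => orliczNorm Φ (gridCube t j) (w x)) ≤ B := by
    have := hB (gridCenter t j) (2 ^ j.1 / 2) (by positivity)
    rw [measure_congr hae, orliczNorm_congr Ψ hae (EventuallyEq.refl _ _)]
    simpa only [orliczNorm_congr Φ hae (EventuallyEq.refl _ (w _))] using this
  set Q := gridCube t j
  set G := orliczNorm (conjYoung Φ) Q g
  set H := orliczNorm (conjYoung Ψ) Q h
  set P := ENNReal.ofReal (psi ρ (θ / 3) (gridCenter t j) (2 ^ j.1 / 2))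
  set n : Rd d → ℝ≥0∞ := fun x => orliczNorm Φ Q (w x)
  have hint : ∫⁻ x in Q, (∫⁻ y in Q, w x y * g y) * h x ≤
      2 * volume Q * G * (2 * volume Q * (orliczNorm Ψ Q n * H)) := by
    calc ∫⁻ x in Q, (∫⁻ y in Q, w x y * g y) * h x
        ≤ ∫⁻ x in Q, (2 * volume Q * G) * (n x * h x) := by
          refine lintegral_mono fun x => ?_
          refine (mul_le_mul' (lintegral_mul_le_orliczNorm hΦ h0 hT (w x) hg hG) le_rfl).trans
            (le_of_eq ?_)
          ring
      _ = (2 * volume Q * G) * ∫⁻ x in Q, n x * h x := lintegral_const_mul' _ _ (by finiteness)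
      _ ≤ _ := by
          gcongr
          -- The inner norm `n` is not known to be measurable in x; only `h` has to be.
          exact lintegral_mul_le_orliczNorm hΨ h0 hT n hh hH
  have hpow : volume Q ^ (α / d - 1) * volume Q * volume Q =
      volume Q ^ (α / d + 1 / q - 1 / p) * volume Q ^ (1 + (1 / p - 1 / q)) := by
    nth_rewrite 2 [← ENNReal.rpow_one (volume Q)]
    nth_rewrite 3 [← ENNReal.rpow_one (volume Q)]
    rw [← ENNReal.rpow_add _ _ h0 hT, ← ENNReal.rpow_add _ _ h0 hT, ← ENNReal.rpow_add _ _ h0 hT]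
    congr 1
    ring
  calc _ ≤ volume Q ^ (α / d - 1) / P * (2 * volume Q * G * (2 * volume Q * (orliczNorm Ψ Q n * H))) := by
        gcongr
    _ = 4 * ((volume Q ^ (α / d - 1) * volume Q * volume Q) * P⁻¹ * orliczNorm Ψ Q n) * (G * H) := by
        rw [ENNReal.div_eq_inv_mul]; ring
    _ = 4 * (volume Q ^ (α / d + 1 / q - 1 / p) / P * orliczNorm Ψ Q n) *
          (volume Q ^ (1 + (1 / p - 1 / q)) * (G * H)) := by
        rw [hpow, ENNReal.div_eq_inv_mul]; ring
    _ ≤ _ := by gcongr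

/-- The bilinear form on bounded functions. -/
lemma bilinear_le {d : ℕ} {ρ : Rd d → ℝ} {k : ℝ → Rd d → Rd d → ℂ}
    (hρ : IsCriticalRadius ρ) (hb : HeatKernelBound ρ k)
    {α p q s θ : ℝ} (hα : 0 < α) (hαd : α < d) (hθ : 0 ≤ θ) (hpq : p < q) (hp : 1 < p)
    (hps : p ≤ s) (hsq : s ≤ q) {Φ Ψ : ℝ → ℝ} (hΦ : IsYoung Φ) (hΨ : IsYoung Ψ)
    (hΦB : MemB (conjYoung Φ) p s) (hΨB : MemB (conjYoung Ψ) (q / (q - 1)) (s / (s - 1))) :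
    ∃ C : ℝ≥0, ∀ (w : Rd d → Rd d → ℝ≥0∞) (B : ℝ≥0∞), Measurable (Function.uncurry w) →
      BumpBound ρ p q α θ Φ Ψ w B →
      ∀ (g h : Rd d → ℝ≥0∞) (N : ℝ≥0), Measurable g → Measurable h → (∀ x, g x ≤ N) →
        (∀ x, h x ≤ N) →
        ∫⁻ x, posOp (absKernel k α) w g x * h x ≤ C * B *
          ((∫⁻ x, g x ^ p) ^ (1 / p) * (∫⁻ x, h x ^ (q / (q - 1))) ^ (1 / (q / (q - 1)))) := by
  classical
  have hd0 : (0 : ℝ) < d := hα.trans hαd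
  have hd : d ≠ 0 := by rintro rfl; simp at hd0
  obtain ⟨C₁, hC₁, hK⟩ := absKernel_le_gridCube hρ hb hα hαd hθ
  have hs1 : 1 < s := hp.trans_le hps
  have hq1 : 1 < q := hp.trans hpq
  have hq'0 : 0 < q / (q - 1) := div_pos (by linarith) (by linarith)
  have hs'0 : 0 < s / (s - 1) := div_pos (by linarith) (by linarith)
  have hδ : 0 < (1 / p - 1 / q) / 2 := by
    have : 1 / q < 1 / p := one_div_lt_one_div_of_lt (by linarith) hpq
    linarith
  set C₂ : ℝ := (1 - (2 : ℝ) ^ (-(d * ((1 / p - 1 / q) / 2))))⁻¹ with hC₂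
  have hC₂0 : 0 ≤ C₂ := by
    refine inv_nonneg.2 (sub_nonneg.2 (Real.rpow_le_one_of_one_le_of_nonpos one_le_two ?_))
    rw [neg_nonpos]; positivity
  have hsum := fun (t : Fin d → Bool) (g h : Rd d → ℝ≥0∞) hg hh N hgN hhN T =>
    nested_sum_le (nestedFamily_gridCube t hd) hΦ.orliczFun_conj hΨ.orliczFun_conj hp hps hsq hpq
      hC₂0 (sum_volume_gridCube_rpow_le t hd hδ) (g := g) (h := h) hg hh N hgN hhN T
  have hA := tsum_bCoeff_lt_top hΦ.orliczFun_conj (by linarith) (by linarith) hΦB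
  have hB := tsum_bCoeff_lt_top hΨ.orliczFun_conj hq'0 hs'0 hΨB
  set K₀ := ENNReal.ofReal (4 * C₂) *
      ((ENNReal.ofReal (2 ^ s) * 32 ^ (s / p) *
        (ENNReal.ofReal (2 ^ s) * ∑' k : ℤ, bCoeff (conjYoung Φ) p s k)) ^ (1 / s) *
      (ENNReal.ofReal (2 ^ (s / (s - 1))) * 32 ^ (s / (s - 1) / (q / (q - 1))) *
        (ENNReal.ofReal (2 ^ (s / (s - 1))) *
          ∑' k : ℤ, bCoeff (conjYoung Ψ) (q / (q - 1)) (s / (s - 1)) k)) ^ (1 / (s / (s - 1))))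
    with hK₀
  have hK₀T : K₀ ≠ ∞ := by
    rw [hK₀]
    have a1 : (32 : ℝ≥0∞) ^ (s / p) ≠ ∞ := ENNReal.rpow_ne_top_of_nonneg
      (div_nonneg (by linarith) (by linarith)) (by simp)
    have a2 : (32 : ℝ≥0∞) ^ (s / (s - 1) / (q / (q - 1))) ≠ ∞ :=
      ENNReal.rpow_ne_top_of_nonneg (by positivity) (by simp)
    refine ENNReal.mul_ne_top ENNReal.ofReal_ne_top (ENNReal.mul_ne_top
      (ENNReal.rpow_ne_top_of_nonneg ?_ ?_) (ENNReal.rpow_ne_top_of_nonneg ?_ ?_))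
    · exact one_div_nonneg.2 (by linarith)
    · exact ENNReal.mul_ne_top (ENNReal.mul_ne_top ENNReal.ofReal_ne_top a1)
        (ENNReal.mul_ne_top ENNReal.ofReal_ne_top hA.ne)
    · positivity
    · exact ENNReal.mul_ne_top (ENNReal.mul_ne_top ENNReal.ofReal_ne_top a2)
        (ENNReal.mul_ne_top ENNReal.ofReal_ne_top hB.ne)
  clear_value K₀
  -- The factor 2^d counts the grids and 4 comes from the two uses of Hölder.
  refine ⟨(ENNReal.ofReal C₁ * (2 ^ d * (4 * K₀))).toNNReal, fun w B hw hB g h N hg hh hgN hhN => ?_⟩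
  rw [ENNReal.coe_toNNReal (by finiteness)]
  set c : (Fin d → Bool) → ℤ × (Fin d → ℤ) → ℝ≥0∞ := fun t j =>
    volume (gridCube t j) ^ (α / d - 1) /
      ENNReal.ofReal (psi ρ (θ / 3) (gridCenter t j) (2 ^ j.1 / 2)) with hc
  set F : (Fin d → Bool) → ℤ × (Fin d → ℤ) → Rd d → Rd d → ℝ≥0∞ := fun t j x y =>
    (gridCube t j).indicator (fun x => (gridCube t j).indicator (fun y => w x y * g y) y) x with hF
  have hFm : ∀ t j, Measurable (Function.uncurry (F t j)) := by
    intro t j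
    have e : Function.uncurry (F t j) = ((gridCube t j) ×ˢ (gridCube t j)).indicator
        (fun z : Rd d × Rd d => w z.1 z.2 * g z.2) := by
      ext ⟨x, y⟩
      by_cases hx : x ∈ gridCube t j <;> by_cases hy : y ∈ gridCube t j <;>
        simp [Function.uncurry, hF, hx, hy]
    rw [e]
    exact (hw.mul (hg.comp measurable_snd)).indicator
      ((measurableSet_gridCube t j).prod (measurableSet_gridCube t j))
  have hpt : ∀ x y, y ≠ x → absKernel k α x y * (w x y * g y) ≤
      ENNReal.ofReal C₁ * ∑ t, ∑' j, c t j * F t j x y := by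
    intro x y hyx
    obtain ⟨t, j, hx, hy, hle⟩ := hK x y hyx.symm
    calc absKernel k α x y * (w x y * g y)
        ≤ (ENNReal.ofReal C₁ * c t j) * F t j x y := by
          have : F t j x y = w x y * g y := by simp [hF, hx, hy]
          rw [this]
          gcongr
      _ = ENNReal.ofReal C₁ * (c t j * F t j x y) := by ring
      _ ≤ ENNReal.ofReal C₁ * ∑' j, c t j * F t j x y := by
          gcongr
          exact ENNReal.le_tsum j
      _ ≤ _ := by
          gcongr
          exact Finset.single_le_sum (f := fun t => ∑' j, c t j * F t j x y) (fun _ _ => zero_le)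
            (Finset.mem_univ t)
  have hcm : ∀ t j, Measurable fun x => ∫⁻ y, c t j * F t j x y := fun t j =>
    ((hFm t j).const_mul (c t j)).lintegral_prod_right'
  have hFy : ∀ t j x, Measurable fun y => c t j * F t j x y := fun t j x =>
    ((hFm t j).comp measurable_prodMk_left).const_mul _
  have hop : ∀ x, posOp (absKernel k α) w g x ≤
      ENNReal.ofReal C₁ * ∑ t, ∑' j, ∫⁻ y, c t j * F t j x y := by
    intro x
    -- For d > 0 points are null, so the diagonal, where the kernel bound is not available, may be
    -- dropped.
    have : Nontrivial (Rd d) := by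
      have : Nonempty (Fin d) := ⟨⟨0, Nat.pos_of_ne_zero hd⟩⟩
      infer_instance
    calc posOp (absKernel k α) w g x
        ≤ ∫⁻ y, ENNReal.ofReal C₁ * ∑ t, ∑' j, c t j * F t j x y := by
          refine lintegral_mono_ae ?_
          filter_upwards [Measure.ae_ne volume x] with y hy using hpt x y hy
      _ = _ := by
          rw [lintegral_const_mul' _ _ ENNReal.ofReal_ne_top, lintegral_finsetSum]
          · congr 1
            refine Finset.sum_congr rfl fun t _ => ?_
            rw [lintegral_tsum fun j => (hFy t j x).aemeasurable]
          · exact fun t _ => Measurable.tsum fun j => hFy t j x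
  have hdy : ∀ t j, ∫⁻ x, (∫⁻ y, c t j * F t j x y) * h x =
      c t j * ∫⁻ x in gridCube t j, (∫⁻ y in gridCube t j, w x y * g y) * h x := by
    intro t j
    have hms := measurableSet_gridCube t j
    rw [← lintegral_indicator hms, ← lintegral_const_mul]
    · refine lintegral_congr fun x => ?_
      have hFx : Measurable fun y => F t j x y := (hFm t j).comp measurable_prodMk_left
      rw [lintegral_const_mul _ hFx, mul_assoc]
      congr 1
      by_cases hx : x ∈ gridCube t j
      · simp only [hF, Set.indicator_of_mem hx]
        rw [lintegral_indicator hms]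
      · simp [hF, hx]
    · refine Measurable.indicator (Measurable.mul ?_ hh) hms
      have : Measurable (fun z : Rd d × Rd d => w z.1 z.2 * g z.2) :=
        hw.mul (hg.comp measurable_snd)
      exact this.lintegral_prod_right'
  calc ∫⁻ x, posOp (absKernel k α) w g x * h x
      ≤ ∫⁻ x, ENNReal.ofReal C₁ * ∑ t, ∑' j, (∫⁻ y, c t j * F t j x y) * h x := by
        refine lintegral_mono fun x => (mul_le_mul' (hop x) le_rfl).trans (le_of_eq ?_)
        rw [mul_assoc, Finset.sum_mul]
        congr 1
        exact Finset.sum_congr rfl fun t _ => ENNReal.tsum_mul_right.symm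
    _ = ENNReal.ofReal C₁ * ∑ t, ∑' j, ∫⁻ x, (∫⁻ y, c t j * F t j x y) * h x := by
        rw [lintegral_const_mul' _ _ ENNReal.ofReal_ne_top, lintegral_finsetSum]
        · congr 1
          refine Finset.sum_congr rfl fun t _ => ?_
          exact lintegral_tsum fun j => ((hcm t j).mul hh).aemeasurable
        · exact fun t _ => Measurable.tsum fun j => (hcm t j).mul hh
    _ ≤ ENNReal.ofReal C₁ * ∑ t : Fin d → Bool, 4 * B * (K₀ * ((∫⁻ x, g x ^ p) ^ (1 / p) *
          (∫⁻ x, h x ^ (q / (q - 1))) ^ (1 / (q / (q - 1))))) := by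
        gcongr with t
        calc _ ≤ ∑' j, 4 * B * (volume (gridCube t j) ^ (1 + (1 / p - 1 / q)) *
              (orliczNorm (conjYoung Φ) (gridCube t j) g *
                orliczNorm (conjYoung Ψ) (gridCube t j) h)) := by
              refine ENNReal.tsum_le_tsum fun j => ?_
              rw [hdy t j]
              exact gridCube_bilinear_le hd hΦ hΨ hB hg hh N hgN hhN t j
          _ ≤ _ := by
              rw [ENNReal.tsum_mul_left]
              gcongr
              rw [ENNReal.tsum_eq_iSup_sum]
              exact iSup_le fun T => hsum t g h hg hh N hgN hhN T
    _ = _ := by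
        rw [Finset.sum_const, Finset.card_univ, Fintype.card_fun, Fintype.card_bool,
          Fintype.card_fin, nsmul_eq_mul]
        push_cast
        ring

/-- The strong type estimate for the positive operator. -/
lemma posOp_strong_type {d : ℕ} {ρ : Rd d → ℝ} {k : ℝ → Rd d → Rd d → ℂ}
    (hk : Measurable fun z : ℝ × Rd d × Rd d => k z.1 z.2.1 z.2.2)
    (hρ : IsCriticalRadius ρ) (hb : HeatKernelBound ρ k)
    {α p q s θ : ℝ} (hα : 0 < α) (hαd : α < d) (hθ : 0 ≤ θ) (hpq : p < q) (hp : 1 < p)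
    (hps : p ≤ s) (hsq : s ≤ q) {Φ Ψ : ℝ → ℝ} (hΦ : IsYoung Φ) (hΨ : IsYoung Ψ)
    (hΦB : MemB (conjYoung Φ) p s) (hΨB : MemB (conjYoung Ψ) (q / (q - 1)) (s / (s - 1))) :
    ∃ C : ℝ≥0, ∀ (w : Rd d → Rd d → ℝ≥0∞) (B : ℝ≥0∞), Measurable (Function.uncurry w) →
      BumpBound ρ p q α θ Φ Ψ w B → ∀ g : Rd d → ℝ≥0∞, Measurable g → (∀ x, g x ≠ ∞) →
        (∫⁻ x, posOp (absKernel k α) w g x ^ q) ^ (1 / q) ≤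
          C * B * (∫⁻ x, g x ^ p) ^ (1 / p) := by
  obtain ⟨C, hC⟩ := bilinear_le hρ hb hα hαd hθ hpq hp hps hsq hΦ hΨ hΦB hΨB
  refine ⟨C, fun w B hw hB g hg hgT => ?_⟩
  have hq1 : 1 < q := hp.trans hpq
  have hq0 : 0 < q := by linarith
  have hp0 : 0 < p := by linarith
  have hKm := measurable_absKernel hk α
  set Y := C * B * (∫⁻ x, g x ^ p) ^ (1 / p) with hY
  set gN : ℕ → Rd d → ℝ≥0∞ := fun N x => min (g x) N with hgN
  have hgNm : ∀ N, Measurable (gN N) := fun N => hg.min measurable_const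
  set FN : ℕ → Rd d → ℝ≥0∞ := fun N => posOp (absKernel k α) w (gN N) with hFN
  have hFNm : ∀ N, Measurable (FN N) := fun N => measurable_posOp hKm hw (hgNm N)
  -- Truncation in height and support makes the q-th power integral finite, so that it can be
  -- absorbed, and makes `E N ^ (q - 1)` an admissible bounded test function.
  set E : ℕ → Rd d → ℝ≥0∞ := fun N =>
    (Metric.ball (0 : Rd d) N).indicator fun x => min (FN N x) N with hE
  have hEm : ∀ N, Measurable (E N) := fun N =>
    ((hFNm N).min measurable_const).indicator measurableSet_ball
  have hEN : ∀ N x, E N x ≤ N := by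
    intro N x
    by_cases hx : x ∈ Metric.ball (0 : Rd d) N <;> simp [hE, hx]
  have hEF : ∀ N x, E N x ≤ FN N x := by
    intro N x
    by_cases hx : x ∈ Metric.ball (0 : Rd d) N <;> simp [hE, hx]
  have hbound : ∀ N, ∫⁻ x, E N x ^ q ≤ Y ^ q := by
    intro N
    set X := ∫⁻ x, E N x ^ q with hX
    have hXT : X ≠ ∞ := by
      refine ne_top_of_le_ne_top ?_ (lintegral_mono (g := (Metric.ball (0 : Rd d) N).indicator
        fun _ => (N : ℝ≥0∞) ^ q) fun x => ?_)
      · rw [lintegral_indicator_const measurableSet_ball]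
        exact ENNReal.mul_ne_top (ENNReal.rpow_ne_top_of_nonneg hq0.le (ENNReal.natCast_ne_top N))
          measure_ball_lt_top.ne
      · by_cases hx : x ∈ Metric.ball (0 : Rd d) N
        · rw [Set.indicator_of_mem hx]
          exact ENNReal.rpow_le_rpow (hEN N x) hq0.le
        · simp [hE, hx, hq0]
    by_cases hX0 : X = 0
    · rw [hX0]; exact zero_le
    set M : ℝ≥0 := max (N : ℝ≥0) ((N : ℝ≥0) ^ (q - 1)) with hM
    have h1 := hC w B hw hB (gN N) (fun x => E N x ^ (q - 1)) M (hgNm N) ((hEm N).pow_const _)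
      (fun x => by
        refine (min_le_right _ _).trans ?_
        exact_mod_cast (le_max_left _ _ : (N : ℝ≥0) ≤ M))
      (fun x => by
        refine (ENNReal.rpow_le_rpow (hEN N x) (by linarith)).trans ?_
        have : ((N : ℝ≥0∞)) ^ (q - 1) = (((N : ℝ≥0) ^ (q - 1) : ℝ≥0) : ℝ≥0∞) := by
          rw [ENNReal.coe_rpow_of_nonneg _ (by linarith)]
          simp
        rw [this]
        exact_mod_cast le_max_right _ _)
    have h2 : X ≤ ∫⁻ x, FN N x * E N x ^ (q - 1) := by
      refine lintegral_mono fun x => ?_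
      calc E N x ^ q = E N x ^ (1 : ℝ) * E N x ^ (q - 1) := by
            rw [← ENNReal.rpow_add_of_nonneg _ _ zero_le_one (by linarith)]; congr 1; ring
        _ ≤ _ := by
            rw [ENNReal.rpow_one]
            gcongr
            exact hEF N x
    have h3 : ∫⁻ x, (E N x ^ (q - 1)) ^ (q / (q - 1)) = X := by
      refine lintegral_congr fun x => ?_
      rw [← ENNReal.rpow_mul]
      congr 1
      have : q - 1 ≠ 0 := by linarith
      field_simp
    rw [h3] at h1
    have h4 : X ≤ Y * X ^ (1 - 1 / q) := by
      refine (h2.trans h1).trans ?_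
      rw [hY, ← mul_assoc]
      have e : 1 / (q / (q - 1)) = 1 - 1 / q := by field_simp
      rw [e]
      gcongr with x
      exact min_le_left _ _
    have h5 : X ^ (1 / q) ≤ Y := by
      have h6 : X ^ (1 / q) * X ^ (1 - 1 / q) ≤ Y * X ^ (1 - 1 / q) := by
        rw [← ENNReal.rpow_add _ _ hX0 hXT]
        simpa using h4
      refine (ENNReal.mul_le_mul_iff_left ?_ ?_).1 h6
      · simp [ENNReal.rpow_eq_zero_iff, hX0, hXT]
      · exact ENNReal.rpow_ne_top_of_ne_zero hX0 hXT
    calc X = (X ^ (1 / q)) ^ q := by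
          rw [← ENNReal.rpow_mul, one_div_mul_cancel hq0.ne', ENNReal.rpow_one]
      _ ≤ Y ^ q := ENNReal.rpow_le_rpow h5 hq0.le
  have hlim : ∀ x, Tendsto (fun N => E N x ^ q) atTop (𝓝 (posOp (absKernel k α) w g x ^ q)) := by
    intro x
    refine (ENNReal.continuous_rpow_const.tendsto _).comp ?_
    have hF : Tendsto (fun N => FN N x) atTop (𝓝 (posOp (absKernel k α) w g x)) := by
      refine lintegral_tendsto_of_tendsto_of_monotone (fun N => ?_) ?_ ?_
      · exact ((hKm.comp measurable_prodMk_left).mul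
          ((hw.comp measurable_prodMk_left).mul (hgNm N))).aemeasurable
      · refine ae_of_all _ fun y a b hab => ?_
        have : gN a y ≤ gN b y := min_le_min le_rfl (by exact_mod_cast hab)
        exact mul_le_mul' le_rfl (mul_le_mul' le_rfl this)
      · refine ae_of_all _ fun y => ?_
        refine tendsto_const_nhds.congr' ?_
        obtain ⟨n, hn⟩ := ENNReal.exists_nat_gt (hgT y)
        filter_upwards [eventually_ge_atTop n] with N hN
        have : gN N y = g y := min_eq_left (hn.le.trans (by exact_mod_cast hN))
        rw [this]
    have hmin : Tendsto (fun N : ℕ => min (FN N x) (N : ℝ≥0∞)) atTop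
        -- The limit is correct even where the operator is infinite, so finiteness a.e. is a
        -- consequence and not an assumption.
        (𝓝 (min (posOp (absKernel k α) w g x) ∞)) :=
      hF.min ENNReal.tendsto_nat_nhds_top
    rw [min_eq_left le_top] at hmin
    refine hmin.congr' ?_
    obtain ⟨n, hn⟩ := exists_nat_gt ‖x‖
    filter_upwards [eventually_ge_atTop n] with N hN
    have hx : x ∈ Metric.ball (0 : Rd d) N := by
      rw [mem_ball_zero_iff]
      exact hn.trans_le (by exact_mod_cast hN)
    simp only [hE, Set.indicator_of_mem hx]
  have hfin : ∫⁻ x, posOp (absKernel k α) w g x ^ q ≤ Y ^ q := by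
    calc ∫⁻ x, posOp (absKernel k α) w g x ^ q = ∫⁻ x, liminf (fun N => E N x ^ q) atTop :=
          lintegral_congr fun x => (hlim x).liminf_eq.symm
      _ ≤ liminf (fun N => ∫⁻ x, E N x ^ q) atTop :=
          lintegral_liminf_le fun N => (hEm N).pow_const _
      _ ≤ Y ^ q := liminf_le_of_le (by isBoundedDefault) fun b hb => by
          obtain ⟨N, hN⟩ := hb.exists
          exact hN.trans (hbound N)
  calc _ ≤ (Y ^ q) ^ (1 / q) := ENNReal.rpow_le_rpow hfin (by positivity)
    _ = Y := by rw [← ENNReal.rpow_mul, mul_one_div_cancel hq0.ne', ENNReal.rpow_one]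

/-! ### Powers of positive definite matrices -/

section mpow
variable {n : ℕ} {A : Matrix (Fin n) (Fin n) ℂ}

lemma spectrum_pos_of_posDef (hA : A.PosDef) {s : ℝ} (hs : s ∈ spectrum ℝ A) : 0 < s := by
  rw [hA.1.spectrum_real_eq_range_eigenvalues] at hs
  obtain ⟨i, rfl⟩ := hs
  exact hA.eigenvalues_pos i

lemma continuousOn_rpow_spectrum (hA : A.PosDef) (r : ℝ) :
    ContinuousOn (fun s : ℝ => s ^ r) (spectrum ℝ A) :=
  continuousOn_id.rpow_const fun _ hs => Or.inl (spectrum_pos_of_posDef hA hs).ne'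

lemma mpow_mpow (hA : A.PosDef) (a b : ℝ) : mpow (mpow A a) b = mpow A (a * b) := by
  unfold mpow
  have hsa : IsSelfAdjoint A := hA.1
  rw [← cfc_comp' (fun s : ℝ => s ^ b) (fun s : ℝ => s ^ a) A ?_ (continuousOn_rpow_spectrum hA a)]
  · refine cfc_congr fun s hs => ?_
    exact (Real.rpow_mul (spectrum_pos_of_posDef hA hs).le a b).symm
  · rintro _ ⟨s, hs, rfl⟩
    have h0 : (s ^ a : ℝ) ≠ 0 := (Real.rpow_pos_of_pos (spectrum_pos_of_posDef hA hs) a).ne'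
    exact (Real.continuousAt_rpow_const _ _ (Or.inl h0)).continuousWithinAt

lemma mpow_neg_mul_mpow (hA : A.PosDef) (a : ℝ) : mpow A (-a) * mpow A a = 1 := by
  unfold mpow
  have hsa : IsSelfAdjoint A := hA.1
  rw [← cfc_mul _ _ A (continuousOn_rpow_spectrum hA _) (continuousOn_rpow_spectrum hA _)]
  rw [cfc_congr (g := fun _ => (1 : ℝ)) fun s hs => ?_, cfc_const_one ℝ A]
  have := spectrum_pos_of_posDef hA hs
  show s ^ (-a) * s ^ a = 1
  rw [← Real.rpow_add this, neg_add_cancel, Real.rpow_zero]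

lemma toOp_mul (A B : Matrix (Fin n) (Fin n) ℂ) : toOp (A * B) = toOp A * toOp B :=
  map_mul (Matrix.toEuclideanCLM (𝕜 := ℂ)) A B

lemma toOp_one : toOp (1 : Matrix (Fin n) (Fin n) ℂ) = 1 :=
  map_one (Matrix.toEuclideanCLM (𝕜 := ℂ))

lemma toOp_mpow_neg_apply (hA : A.PosDef) (a : ℝ) (v : Cn n) :
    toOp (mpow A (-a)) (toOp (mpow A a) v) = v := by
  have : (toOp (mpow A (-a)) * toOp (mpow A a)) v = v := by
    rw [← toOp_mul, mpow_neg_mul_mpow hA, toOp_one]; rfl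
  exact this

lemma continuous_toOp : Continuous (toOp : Matrix (Fin n) (Fin n) ℂ → Cn n →L[ℂ] Cn n) :=
  (Matrix.toEuclideanCLM (𝕜 := ℂ) (n := Fin n)).toAlgEquiv.toLinearMap.continuous_of_finiteDimensional

/-- Polynomials converging to `s ^ r` on `(0, ∞)`. -/
lemma exists_polynomial_tendsto_rpow (r : ℝ) :
    ∃ P : ℕ → Polynomial ℝ, ∀ s : ℝ, 0 < s → Tendsto (fun j => (P j).eval s) atTop (𝓝 (s ^ r)) := by
  -- Weierstrass on compact intervals exhausting (0, ∞), with errors tending to 0.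
  have h : ∀ j : ℕ, ∃ P : Polynomial ℝ, ∀ s ∈ Set.Icc ((j : ℝ) + 1)⁻¹ ((j : ℝ) + 1),
      |P.eval s - s ^ r| < ((j : ℝ) + 1)⁻¹ := by
    intro j
    refine exists_polynomial_near_of_continuousOn _ _ _ ?_ _ (by positivity)
    refine continuousOn_id.rpow_const fun s hs => Or.inl ?_
    have : 0 < ((j : ℝ) + 1)⁻¹ := by positivity
    exact (this.trans_le hs.1).ne'
  choose P hP using h
  refine ⟨P, fun s hs => ?_⟩
  rw [tendsto_iff_norm_sub_tendsto_zero]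
  have h0 : Tendsto (fun j : ℕ => ((j : ℝ) + 1)⁻¹) atTop (𝓝 0) := by
    simpa using tendsto_one_div_add_atTop_nhds_zero_nat (𝕜 := ℝ)
  have h1 : Tendsto (fun j : ℕ => (j : ℝ) + 1) atTop atTop :=
    tendsto_atTop_add_const_right _ _ tendsto_natCast_atTop_atTop
  refine squeeze_zero' (Eventually.of_forall fun _ => norm_nonneg _) ?_ h0
  filter_upwards [h0.eventually_le_const hs, h1.eventually_ge_atTop s] with j hj1 hj2
  exact (hP j s ⟨hj1, hj2⟩).le

/-- In an eigenbasis of A both sides are diagonal, so convergence at the finitely many eigenvalues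
is enough. -/
lemma tendsto_aeval_mpow (hA : A.PosDef) {r : ℝ} {P : ℕ → Polynomial ℝ}
    (hP : ∀ s : ℝ, 0 < s → Tendsto (fun j => (P j).eval s) atTop (𝓝 (s ^ r))) :
    Tendsto (fun j => toOp (Polynomial.aeval A (P j))) atTop (𝓝 (toOp (mpow A r))) := by
  have hsa : IsSelfAdjoint A := hA.1
  refine (continuous_toOp.tendsto _).comp ?_
  unfold mpow
  simp only [← cfc_polynomial _ A hsa, hA.1.cfc_eq, Matrix.IsHermitian.cfc,
    Unitary.conjStarAlgAut_apply]
  refine ((continuous_const.matrix_mul continuous_id).matrix_mul continuous_const).tendsto _ |>.comp ?_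
  refine (continuous_id.matrix_diagonal.tendsto _).comp ?_
  refine tendsto_pi_nhds.2 fun i => ?_
  exact (RCLike.continuous_ofReal.tendsto _).comp (hP _ (hA.eigenvalues_pos i))

lemma aestronglyMeasurable_toOp {d : ℕ} {W : Rd d → Matrix (Fin n) (Fin n) ℂ}
    (hW : ∀ i j, AEStronglyMeasurable (fun x => W x i j) volume) :
    AEStronglyMeasurable (fun x => toOp (W x)) volume := by
  refine continuous_toOp.comp_aestronglyMeasurable (g := toOp) ?_
  have e : W = fun x => ∑ i, ∑ j, W x i j • Matrix.single i j (1 : ℂ) := by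
    funext x
    conv_lhs => rw [Matrix.matrix_eq_sum_single (W x)]
    simp [Matrix.smul_single]
  rw [e]
  refine Finset.aestronglyMeasurable_fun_sum _ fun i _ =>
    Finset.aestronglyMeasurable_fun_sum _ fun j _ => (hW i j).smul_const _

/-- One polynomial sequence serves every x, so the power is an a.e. limit of polynomials in W(x); no
measurable choice of eigenvectors is needed. -/
lemma aestronglyMeasurable_toOp_mpow {d : ℕ} {W : Rd d → Matrix (Fin n) (Fin n) ℂ}
    (hW : IsMatrixWeight W) (r : ℝ) :
    AEStronglyMeasurable (fun x => toOp (mpow (W x) r)) volume := by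
  obtain ⟨P, hP⟩ := exists_polynomial_tendsto_rpow r
  have h0 := aestronglyMeasurable_toOp fun i j => (hW.locallyIntegrable i j).aestronglyMeasurable
  refine aestronglyMeasurable_of_tendsto_ae atTop
    (f := fun j x => toOp (Polynomial.aeval (W x) (P j))) (fun j => ?_) ?_
  · have e : ∀ A : Matrix (Fin n) (Fin n) ℂ, toOp (Polynomial.aeval A (P j)) =
        Polynomial.aeval (toOp A) (P j) := fun A =>
      (Polynomial.aeval_algHom_apply
        ((Matrix.toEuclideanCLM (𝕜 := ℂ) (n := Fin n)).toAlgEquiv.toAlgHom.restrictScalars ℝ)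
        A (P j)).symm
    simp only [e]
    exact (Polynomial.continuous_aeval (P j)).comp_aestronglyMeasurable h0
  · filter_upwards [hW.posDef] with x hx using tendsto_aeval_mpow hx hP

end mpow

/-! ### The fractional integral on weighted spaces -/

section frac
variable {d n : ℕ} {k : ℝ → Rd d → Rd d → ℂ} {α : ℝ}

lemma lintegral_prod_absKernel
    (hk : Measurable fun z : ℝ × Rd d × Rd d => k z.1 z.2.1 z.2.2) (x : Rd d) {φ : Rd d → ℝ≥0∞}
    (hφ : AEMeasurable φ volume) :
    ∫⁻ z : ℝ × Rd d, ENNReal.ofReal (z.1 ^ (α / 2 - 1)) * ‖k z.1 x z.2‖ₑ * φ z.2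
      ∂((volume.restrict (Set.Ioi (0 : ℝ))).prod volume) = ∫⁻ y, absKernel k α x y * φ y := by
  have hm : Measurable fun z : ℝ × Rd d => ENNReal.ofReal (z.1 ^ (α / 2 - 1)) * ‖k z.1 x z.2‖ₑ := by
    refine Measurable.mul (by fun_prop) (Measurable.enorm ?_)
    exact hk.comp (f := fun z : ℝ × Rd d => (z.1, x, z.2)) (by fun_prop)
  have hm' : AEMeasurable (fun z : ℝ × Rd d =>
      ENNReal.ofReal (z.1 ^ (α / 2 - 1)) * ‖k z.1 x z.2‖ₑ * φ z.2)
      ((volume.restrict (Set.Ioi (0 : ℝ))).prod volume) := hm.aemeasurable.mul hφ.comp_snd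
  rw [lintegral_prod_symm _ hm']
  refine lintegral_congr fun y => ?_
  have hmy : Measurable fun t : ℝ => ENNReal.ofReal (t ^ (α / 2 - 1)) * ‖k t x y‖ₑ :=
    hm.comp measurable_prodMk_right
  rw [absKernel]
  exact lintegral_mul_const (μ := volume.restrict (Set.Ioi (0 : ℝ))) (φ y) hmy

lemma aestronglyMeasurable_fracIntegrand
    (hk : Measurable fun z : ℝ × Rd d × Rd d => k z.1 z.2.1 z.2.2) {f : Rd d → Cn n}
    (hf : AEStronglyMeasurable f volume) (x : Rd d) :
    AEStronglyMeasurable (fun z : ℝ × Rd d => fracIntegrand k α f x z.1 z.2)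
      ((volume.restrict (Set.Ioi (0 : ℝ))).prod volume) := by
  have h1 : Measurable fun z : ℝ × Rd d => z.1 ^ (α / 2 - 1) := by fun_prop
  have h2 : Measurable fun z : ℝ × Rd d => k z.1 x z.2 :=
    hk.comp (f := fun z : ℝ × Rd d => (z.1, x, z.2)) (by fun_prop)
  exact h1.aestronglyMeasurable.smul (h2.aestronglyMeasurable.smul hf.comp_snd)

lemma enorm_map_fracIntegrand (T : Cn n →L[ℂ] Cn n) (f : Rd d → Cn n) (x : Rd d) {t : ℝ}
    (ht : 0 < t) (y : Rd d) :
    ‖T (fracIntegrand k α f x t y)‖ₑ =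
      ENNReal.ofReal (t ^ (α / 2 - 1)) * ‖k t x y‖ₑ * ‖T (f y)‖ₑ := by
  unfold fracIntegrand
  rw [T.map_smul_of_tower, map_smul, enorm_smul, enorm_smul, mul_assoc,
    Real.enorm_of_nonneg (Real.rpow_nonneg ht.le _)]

lemma lintegral_enorm_map_fracIntegrand
    (hk : Measurable fun z : ℝ × Rd d × Rd d => k z.1 z.2.1 z.2.2) {f : Rd d → Cn n}
    (hf : AEStronglyMeasurable f volume) (T : Cn n →L[ℂ] Cn n) (x : Rd d) :
    ∫⁻ z : ℝ × Rd d, ‖T (fracIntegrand k α f x z.1 z.2)‖ₑ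
      ∂((volume.restrict (Set.Ioi (0 : ℝ))).prod volume) =
      ∫⁻ y, absKernel k α x y * ‖T (f y)‖ₑ := by
  rw [← lintegral_prod_absKernel hk x (T.continuous.comp_aestronglyMeasurable hf).enorm]
  refine lintegral_congr_ae ?_
  have h : ∀ᵐ z : ℝ × Rd d ∂((volume.restrict (Set.Ioi (0 : ℝ))).prod volume), z.1 ∈ Set.Ioi 0 :=
    Measure.quasiMeasurePreserving_fst.ae (ae_restrict_mem measurableSet_Ioi)
  filter_upwards [h] with z hz using enorm_map_fracIntegrand T f x hz z.2

lemma aestronglyMeasurable_fracInt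
    (hk : Measurable fun z : ℝ × Rd d × Rd d => k z.1 z.2.1 z.2.2) {f : Rd d → Cn n}
    (hf : AEStronglyMeasurable f volume) : AEStronglyMeasurable (fracInt k α f) volume := by
  have e : fracInt k α f = fracInt k α (hf.mk f) := by
    funext x
    unfold fracInt
    refine integral_congr_ae (ae_of_all _ fun t => integral_congr_ae ?_)
    filter_upwards [hf.ae_eq_mk] with y hy
    simp only [fracIntegrand, hy]
  rw [e]
  have hg := hf.stronglyMeasurable_mk
  have h1 : Measurable fun z : (Rd d × ℝ) × Rd d => z.1.2 ^ (α / 2 - 1) := by fun_prop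
  have h2 : Measurable fun z : (Rd d × ℝ) × Rd d => k z.1.2 z.1.1 z.2 :=
    hk.comp (f := fun z : (Rd d × ℝ) × Rd d => (z.1.2, z.1.1, z.2)) (by fun_prop)
  have h3 : StronglyMeasurable fun z : (Rd d × ℝ) × Rd d =>
      fracIntegrand k α (hf.mk f) z.1.1 z.1.2 z.2 :=
    h1.stronglyMeasurable.smul (h2.stronglyMeasurable.smul (hg.comp_measurable measurable_snd))
  exact (h3.integral_prod_right' (ν := volume)).integral_prod_right'.aestronglyMeasurable

/-- Allows measurable representatives of the matrix powers: Luxemburg norms ignore null sets in each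
variable. -/
lemma bumpBound_bumpConst {ρ : Rd d → ℝ} {p q θ : ℝ} {Φ Ψ : ℝ → ℝ}
    {U V : Rd d → Matrix (Fin n) (Fin n) ℂ} {S T : Rd d → Cn n →L[ℂ] Cn n}
    (hS : (fun x => toOp (mpow (U x) (1 / q))) =ᵐ[volume] S)
    (hT : (fun x => toOp (mpow (V x) (-(1 / q)))) =ᵐ[volume] T) :
    BumpBound ρ p q α θ Φ Ψ (fun x y => ‖S x * T y‖ₑ) (bumpConst ρ p q α θ Φ Ψ U V) := by
  intro z r hr
  have key : orliczNorm Ψ (cube z r) (fun x => orliczNorm Φ (cube z r) fun y => ‖S x * T y‖ₑ) =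
      orliczNorm Ψ (cube z r) (fun x => orliczNorm Φ (cube z r) fun y =>
        ‖toOp (mpow (U x) (1 / q) * mpow (V y) (-(1 / q)))‖ₑ) := by
    refine orliczNorm_congr Ψ (EventuallyEq.refl _ _) ?_
    filter_upwards [hS] with x hx
    refine orliczNorm_congr Φ (EventuallyEq.refl _ _) ?_
    filter_upwards [hT] with y hy
    rw [toOp_mul, hx, hy]
  rw [key]
  unfold bumpConst
  exact le_iSup_of_le z (le_iSup_of_le r (le_iSup_of_le hr le_rfl))

lemma wNorm_eq_lintegral {W : Rd d → Matrix (Fin n) (Fin n) ℂ} {r : ℝ} (hr : 0 < r)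
    (f : Rd d → Cn n) :
    wNorm W r f = (∫⁻ x, ‖toOp (mpow (W x) (1 / r)) (f x)‖ₑ ^ r) ^ (1 / r) := by
  unfold wNorm
  rw [eLpNorm_eq_lintegral_rpow_enorm_toReal (by simpa using hr) ENNReal.ofReal_ne_top,
    ENNReal.toReal_ofReal hr.le]

end frac
end MatrixBump

open MatrixBump in
theorem mainTheorem3 {d n : ℕ} (L : L2 d →ₗ.[ℂ] L2 d) (hL : IsNonnegSelfAdjoint L)
    (k : ℝ → Rd d → Rd d → ℂ) (hk : IsHeatKernel L k)
    (ρ : Rd d → ℝ) (hρ : IsCriticalRadius ρ) (hbound : HeatKernelBound ρ k)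
    (α p q s θ : ℝ) (hα : 0 < α) (hαd : α < d) (hθ : 0 ≤ θ)
    (hpq : p < q) (hp : 1 < p) (hps : p ≤ s) (hsq : s ≤ q)
    (Φ Ψ : ℝ → ℝ) (hΦ : IsYoung Φ) (hΨ : IsYoung Ψ)
    (hΦB : MemB (conjYoung Φ) p s)
    (hΨB : MemB (conjYoung Ψ) (q / (q - 1)) (s / (s - 1))) :
    ∃ C : ℝ≥0, ∀ U V : Rd d → Matrix (Fin n) (Fin n) ℂ,
      IsMatrixWeight U → IsMatrixWeight V →
      bumpConst ρ p q α θ Φ Ψ U V < ∞ →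
      ∀ f : Rd d → Cn n, MemWLp (fun x => mpow (V x) (p / q)) p f →
        (∀ᵐ x ∂volume, Integrable (fun z : ℝ × Rd d => fracIntegrand k α f x z.1 z.2)
          ((volume.restrict (Set.Ioi (0 : ℝ))).prod volume)) ∧
        MemWLp U q (fracInt k α f) ∧
        wNorm U q (fracInt k α f) ≤
          C * bumpConst ρ p q α θ Φ Ψ U V * wNorm (fun x => mpow (V x) (p / q)) p f := by
  have hkm := hk.measurable
  have hp0 : 0 < p := by linarith
  have hq0 : 0 < q := by linarith
  obtain ⟨C, hC⟩ := posOp_strong_type hkm hρ hbound hα hαd hθ hpq hp hps hsq hΦ hΨ hΦB hΨB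
  refine ⟨C, fun U V hU hV hB f hf => ?_⟩
  obtain ⟨hfm, hfT⟩ := hf
  have hS := aestronglyMeasurable_toOp_mpow hU (1 / q)
  have hT := aestronglyMeasurable_toOp_mpow hV (-(1 / q))
  have hR := aestronglyMeasurable_toOp_mpow hV (1 / q)
  have hVf : AEStronglyMeasurable (fun y => toOp (mpow (V y) (1 / q)) (f y)) volume :=
    isBoundedBilinearMap_apply.continuous.comp_aestronglyMeasurable (hR.prodMk hfm)
  set S := hS.mk _ with hSdef
  set T := hT.mk _ with hTdef
  set w : Rd d → Rd d → ℝ≥0∞ := fun x y => ‖S x * T y‖ₑ with hw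
  set g : Rd d → ℝ≥0∞ := fun y => ‖hVf.mk _ y‖ₑ with hg
  have hwm : Measurable (Function.uncurry w) :=
    ((hS.stronglyMeasurable_mk.comp_measurable measurable_fst).mul
      (hT.stronglyMeasurable_mk.comp_measurable measurable_snd)).enorm
  have hgm : Measurable g := hVf.stronglyMeasurable_mk.enorm
  have hstrong := hC w _ hwm (bumpBound_bumpConst hS.ae_eq_mk hT.ae_eq_mk) g hgm
    (fun x => enorm_ne_top)
  have hgnorm : (∫⁻ x, g x ^ p) ^ (1 / p) = wNorm (fun x => mpow (V x) (p / q)) p f := by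
    rw [wNorm_eq_lintegral hp0]
    congr 1
    refine lintegral_congr_ae ?_
    filter_upwards [hVf.ae_eq_mk, hV.posDef] with x hx hxV
    -- The weight V^{p/q} in L^p and the weight V in L^q share the same factor: (V^{p/q})^{1/p} =
    -- V^{1/q}.
    rw [mpow_mpow hxV, show p / q * (1 / p) = 1 / q by field_simp]
    simp only [hg, ← hx]
  rw [hgnorm] at hstrong
  have hfin : (∫⁻ x, posOp (absKernel k α) w g x ^ q) ^ (1 / q) < ∞ :=
    hstrong.trans_lt (ENNReal.mul_lt_top (ENNReal.mul_lt_top ENNReal.coe_lt_top hB) hfT)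
  have hpm : Measurable (posOp (absKernel k α) w g) :=
    measurable_posOp (measurable_absKernel hkm α) hwm hgm
  have hpfin : ∀ᵐ x, posOp (absKernel k α) w g x < ∞ := by
    have h1 : ∫⁻ x, posOp (absKernel k α) w g x ^ q ≠ ∞ := by
      intro h
      rw [h, ENNReal.top_rpow_of_pos (by positivity)] at hfin
      exact lt_irrefl _ hfin
    filter_upwards [ae_lt_top (hpm.pow_const q) h1] with x hx
    by_contra hcon
    rw [not_lt, top_le_iff] at hcon
    rw [hcon, ENNReal.top_rpow_of_pos hq0] at hx
    exact lt_irrefl _ hx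
  -- The reduction to scalars: insert V(y)^{-1/q} V(y)^{1/q} before f(y). The exceptional null set
  -- of y does not depend on x.
  have hptw : ∀ᵐ y, ∀ x, ‖S x (f y)‖ₑ ≤ w x y * g y := by
    filter_upwards [hVf.ae_eq_mk, hT.ae_eq_mk, hV.posDef] with y hy hyT hyV x
    have e : f y = T y (hVf.mk _ y) := by
      rw [hTdef, ← hyT, ← hy, toOp_mpow_neg_apply hyV]
    calc ‖S x (f y)‖ₑ = ‖(S x * T y) (hVf.mk _ y)‖ₑ := by
          conv_lhs => rw [e]
          rfl
      _ ≤ _ := ContinuousLinearMap.le_opENorm _ _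
  have hSle : ∀ x, ∫⁻ y, absKernel k α x y * ‖S x (f y)‖ₑ ≤ posOp (absKernel k α) w g x := by
    intro x
    refine lintegral_mono_ae ?_
    filter_upwards [hptw] with y hy
    exact mul_le_mul' le_rfl (hy x)
  have hint : ∀ᵐ x, Integrable (fun z : ℝ × Rd d => fracIntegrand k α f x z.1 z.2)
      ((volume.restrict (Set.Ioi (0 : ℝ))).prod volume) := by
    filter_upwards [hpfin, hS.ae_eq_mk, hU.posDef] with x hx hxS hxU
    refine ⟨aestronglyMeasurable_fracIntegrand hkm hfm x, ?_⟩
    set A := toOp (mpow (U x) (-(1 / q))) with hA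
    -- For fixed x the matrix U(x)^{1/q} is invertible, so finiteness of the weighted integral gives
    -- absolute convergence without the weight.
    have hle : ∀ v : Cn n, ‖v‖ₑ ≤ ‖A‖ₑ * ‖S x v‖ₑ := by
      intro v
      have : A (S x v) = v := by rw [hSdef, ← hxS, hA, toOp_mpow_neg_apply hxU]
      calc ‖v‖ₑ = ‖A (S x v)‖ₑ := by rw [this]
        _ ≤ _ := ContinuousLinearMap.le_opENorm _ _
    calc ∫⁻ z : ℝ × Rd d, ‖fracIntegrand k α f x z.1 z.2‖ₑ
          ∂((volume.restrict (Set.Ioi (0 : ℝ))).prod volume)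
        ≤ ∫⁻ z : ℝ × Rd d, ‖A‖ₑ * ‖S x (fracIntegrand k α f x z.1 z.2)‖ₑ
          ∂((volume.restrict (Set.Ioi (0 : ℝ))).prod volume) := lintegral_mono fun z => hle _
      _ = ‖A‖ₑ * ∫⁻ y, absKernel k α x y * ‖S x (f y)‖ₑ := by
          rw [lintegral_const_mul' _ _ enorm_ne_top, lintegral_enorm_map_fracIntegrand hkm hfm]
      _ < ∞ := ENNReal.mul_lt_top enorm_lt_top ((hSle x).trans_lt hx)
  have hnorm : wNorm U q (fracInt k α f) ≤ (∫⁻ x, posOp (absKernel k α) w g x ^ q) ^ (1 / q) := by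
    rw [wNorm_eq_lintegral hq0]
    refine ENNReal.rpow_le_rpow (lintegral_mono_ae ?_) (by positivity)
    filter_upwards [hint, hS.ae_eq_mk] with x hx hxS
    refine ENNReal.rpow_le_rpow ?_ hq0.le
    have hxS' : toOp (mpow (U x) (1 / q)) = S x := hxS
    have e : fracInt k α f x = ∫ z : ℝ × Rd d, fracIntegrand k α f x z.1 z.2
        ∂((volume.restrict (Set.Ioi (0 : ℝ))).prod volume) := (integral_prod _ hx).symm
    rw [hxS', e, ← ContinuousLinearMap.integral_comp_comm _ hx]
    refine (enorm_integral_le_lintegral_enorm _).trans ?_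
    rw [lintegral_enorm_map_fracIntegrand hkm hfm]
    exact hSle x
  refine ⟨hint, ⟨aestronglyMeasurable_fracInt hkm hfm, hnorm.trans_lt hfin⟩, hnorm.trans hstrong⟩
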